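/- Let $(\Omega,\mathcal A,\mathbb Q)$ be a probability space, $N\in\mathbb N$, $T\ge 0$, and let $e_1,\dots,e_N$ be the standard basis of $\mathbb R^N$. **Data.** Let $A_t=(A_t^{ij})_{i,j}$, $t\ge 0$, be real $N\times N$ matrices, locally integrable in $t$, with $A_t^{ij}\ge 0$ for $i\ne j$ and zero column sums ($A_t^{ij}$ is the rate of jumping from state $j$ to state $i$). Let $X=(X_t)_{t\ge0}$ be a process with values in $\{e_1,\dots,e_N\}$ and càdlàg paths that is, under $\mathbb Q$, a Markov chain with rate matrix $A_t$ at time $t$: $\mathbb Q(X_t=e_i\mid \sigma(X_r;r\le s))=P(s,t)^{ij}$ a.s. on $\{X_s=e_j\}$ for $s\le t$, where $P(s,\cdot)$ is continuous on $[s,\infty[$ and $P(s,t)=I+\int_{]s,t]}A_uP(s,u)\,du$. Let $\mathbb D$ be the space of counting paths $[0,\infty[\,\to\mathbb N$ (increasing, right-constant, jumps at most $1$) with its canonical filtration, and let $Y$ be a process with paths in $\mathbb D$ which under $\mathbb Q$ is a standard Poisson process independent of $X$. Put $\mathcal Y_t=\sigma(Y_s;s\le t)$ and $\mathcal F_t=\sigma(X_s,Y_s;s\le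 t)$. Let $\lambda(u,e_i,y)>0$ ($u\ge 0$, $1\le i\le N$, $y\in\mathbb D$) be such that $(u,y)\mapsto\lambda(u,e_i,y)$ is predictable for the canonical filtration of $\mathbb D$, for every $i$. Write $\lambda_u=\lambda(u,X_{u-},Y)$ (with $X_{0-}=X_0$), and assume that $\mathbb Q$-almost surely $u\mapsto\lambda_u$ is left-continuous and $\int_{]0,T]}\lambda_u\,du<\infty$. Let $\Lambda_u$ be the diagonal matrix with entries $(\Lambda_u)_{ii}=\lambda(u,e_i,Y)$, and let $$Z_t=\exp\Big(-\int_{]0,t]}(\lambda_u-1)\,du\Big)\prod_{u\in]0,t]}\lambda_u^{\Delta Y_u}.$$ Assume that $Z$ is a true $(\mathbb Q,(\mathcal F_t))$-martingale on $[0,T]$. **Theorem.** There is a $(\mathcal Y_t)$-adapted process $q=(q_t)_{t\in[0,T]}$ with values in $\mathbb R^N$ and $\mathbb Q$-almost surely càdlàg paths such that $q_t=E_{\mathbb Q}[Z_tX_t\mid\mathcal Y_t]$ a.s. for every $t\in[0,T]$. Every such process $q$ has the following two properties. 1. $\mathbb Q$-almost surely, for all $t\in[0,T]$ simultaneously, the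 Lebesgue integrals below converge absolutely and $$q_t=q_0+\int_{]0,t]}(\Lambda_u-I)\,q_{u-}\,(dY_u-du)+\int_{]0,t]}A_u\,q_u\,du .$$ 2. If $\mathbb P$ is a probability measure with $d\mathbb P/d\mathbb Q|_{\mathcal F_t}=Z_t$ for all $t\le T$, then for every $t\in[0,T]$, $\mathbb P$-almost surely, $\langle q_t,\mathbf 1\rangle>0$ and $$E_{\mathbb P}[X_t\mid\mathcal Y_t]=\frac{q_t}{\langle q_t,\mathbf 1\rangle}.$$ -/

import Mathlib

open MeasureTheory ProbabilityTheory Filter Set Topology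
open scoped NNReal ENNReal Matrix

noncomputable section

namespace CountingFilter

/-! ### Paths -/

/-- Lebesgue measure on the set of times `[0,∞[`. -/
def leb : Measure ℝ≥0 := Measure.comap (fun t : ℝ≥0 => (t : ℝ)) volume

/-- `f` is right-continuous with left limits on the set of times `I`. -/
def IsCadlagOn {E : Type*} [TopologicalSpace E] (I : Set ℝ≥0) (f : ℝ≥0 → E) : Prop :=
  ∀ t ∈ I, ContinuousWithinAt f (I ∩ Ici t) t ∧ ∃ l, Tendsto f (𝓝[I ∩ Iio t] t) (𝓝 l)

/-- The jump `y t - y (t-)` of an increasing integer-valued path (with `y (0-) = y 0`, so that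
there is no jump at time `0`). -/
def jump (y : ℝ≥0 → ℕ) (t : ℝ≥0) : ℕ := y t - Function.leftLim y t

/-- A counting path: integer valued, increasing, right-constant, with jumps of at most one. -/
structure IsCountingPath (y : ℝ≥0 → ℕ) : Prop where
  monotone : Monotone y
  right_constant : ∀ t, ∀ᶠ s in 𝓝[≥] t, y s = y t
  jump_le_one : ∀ t, jump y t ≤ 1

/-- The space of counting paths, with the σ-algebra generated by the evaluations. -/
abbrev CountingPath : Type := {y : ℝ≥0 → ℕ // IsCountingPath y}

theorem measurable_eval (t : ℝ≥0) : Measurable fun y : CountingPath => y.1 t :=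
  (measurable_pi_apply t).comp measurable_subtype_coe

/-- The canonical filtration of the space of counting paths. -/
def pathFiltration : Filtration ℝ≥0 (inferInstance : MeasurableSpace CountingPath) :=
  Filtration.natural (fun t (y : CountingPath) => y.1 t)
    fun t => (measurable_eval t).stronglyMeasurable

/-- The integral `∫_{]0,t]} h_u dy_u` along a counting path, a pure jump path with finitely many
jumps in `]0,t]`: the sum of `h_u Δy_u` over the jump times `u` in `]0,t]`. -/
def jumpIntegral {E : Type*} [AddCommGroup E] [Module ℝ E]
    (y : CountingPath) (t : ℝ≥0) (h : ℝ≥0 → E) : E :=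
  ∑ᶠ (u : ℝ≥0) (_ : u ∈ Ioc 0 t), (jump y.1 u : ℝ) • h u

/-! ### The hidden chain -/

/-- The `i`-th standard basis vector of `ℝ^N`. -/
def basisVec {N : ℕ} (i : Fin N) : Fin N → ℝ := Pi.single i 1

/-- `A t` is a matrix of jump rates for every `t`; the entry `A t i j` is the rate of jumping from
state `j` to state `i`. -/
structure IsRateMatrix {N : ℕ} (A : ℝ≥0 → Matrix (Fin N) (Fin N) ℝ) : Prop where
  offDiag_nonneg : ∀ t i j, i ≠ j → 0 ≤ A t i j
  colSum_eq_zero : ∀ t j, ∑ i, A t i j = 0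
  locallyIntegrable : ∀ i j, LocallyIntegrable (fun t => A t i j) leb

/-- `P s t` (for `s ≤ t`) is the family of transition matrices generated by the rates `A`: it
solves the Kolmogorov forward equation `P s t = 1 + ∫_s^t A_u P(s,u) du`. -/
structure IsTransitionFamily {N : ℕ} (A : ℝ≥0 → Matrix (Fin N) (Fin N) ℝ)
    (P : ℝ≥0 → ℝ≥0 → Matrix (Fin N) (Fin N) ℝ) : Prop where
  continuousOn : ∀ s, ContinuousOn (P s) (Ici s)
  forward : ∀ s t, s ≤ t → ∀ i j,
    P s t i j = (1 : Matrix (Fin N) (Fin N) ℝ) i j + ∫ u in Ioc s t, (A u * P s u) i j ∂leb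

variable {Ω : Type*} {m : MeasurableSpace Ω} {N : ℕ}

/-- `X` is, under `Q`, a Markov chain (with càdlàg paths) with rate matrix `A t` at time `t`. The
state `i` stands for the basis vector `basisVec i`. -/
structure IsMarkovChain (A : ℝ≥0 → Matrix (Fin N) (Fin N) ℝ) (X : ℝ≥0 → Ω → Fin N)
    (hX : ∀ t, Measurable (X t)) (Q : Measure Ω) : Prop where
  isRateMatrix : IsRateMatrix A
  cadlag : ∀ ω, IsCadlagOn univ fun t => X t ω
  markov : ∃ P, IsTransitionFamily A P ∧ ∀ s t, s ≤ t → ∀ i,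
    Q[(X t ⁻¹' {i}).indicator (fun _ => (1 : ℝ)) |
        Filtration.natural X (fun r => (hX r).stronglyMeasurable) s]
      =ᵐ[Q] fun ω => P s t i (X s ω)

/-! ### The observations -/

/-- `Y` is, under `Q`, a standard Poisson process. -/
structure IsStandardPoisson (Y : Ω → CountingPath) (Q : Measure Ω) : Prop where
  zero : ∀ᵐ ω ∂Q, (Y ω).1 0 = 0
  indep : HasIndepIncrements (fun t ω => (Y ω).1 t) Q
  law : ∀ s t : ℝ≥0, s ≤ t → HasLaw (fun ω => (Y ω).1 t - (Y ω).1 s) (poissonMeasure (t - s)) Q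

/-- The observation filtration `𝒴_t = σ(Y_s ; s ≤ t)`. -/
def obsFiltration (Y : Ω → CountingPath) (hY : Measurable Y) : Filtration ℝ≥0 m :=
  Filtration.natural (fun t ω => (Y ω).1 t)
    fun t => ((measurable_eval t).comp hY).stronglyMeasurable

/-- The full filtration `𝓕_t = σ(X_s, Y_s ; s ≤ t)`. -/
def fullFiltration (X : ℝ≥0 → Ω → Fin N) (hX : ∀ t, Measurable (X t))
    (Y : Ω → CountingPath) (hY : Measurable Y) : Filtration ℝ≥0 m :=
  Filtration.natural (fun t ω => (X t ω, (Y ω).1 t))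
    fun t => ((hX t).prodMk ((measurable_eval t).comp hY)).stronglyMeasurable

/-! ### The intensity and the density -/

/-- `lam i t y` is the intensity in state `i` at time `t` given the observed path `y`: it is
strictly positive and predictable in the path. -/
structure IsIntensity (lam : Fin N → ℝ≥0 → CountingPath → ℝ) : Prop where
  pos : ∀ i t y, 0 < lam i t y
  predictable : ∀ i, IsStronglyPredictable pathFiltration (lam i)

/-- The intensity `λ_u = λ(X_{u-}, u, Y)`. -/
def intensity (lam : Fin N → ℝ≥0 → CountingPath → ℝ) (X : ℝ≥0 → Ω → Fin N)
    (Y : Ω → CountingPath) (u : ℝ≥0) (ω : Ω) : ℝ :=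
  lam (Function.leftLim (fun s => X s ω) u) u (Y ω)

/-- The diagonal matrix `Λ_u` of state-wise intensities. -/
def Lam (lam : Fin N → ℝ≥0 → CountingPath → ℝ) (u : ℝ≥0) (y : CountingPath) :
    Matrix (Fin N) (Fin N) ℝ :=
  Matrix.diagonal fun i => lam i u y

/-- The density `Z_t = exp (-∫_{]0,t]} (λ_u - 1) du) ∏_{u ∈ ]0,t]} λ_u ^ ΔY_u`. -/
def density (lam : Fin N → ℝ≥0 → CountingPath → ℝ) (X : ℝ≥0 → Ω → Fin N)
    (Y : Ω → CountingPath) (t : ℝ≥0) (ω : Ω) : ℝ :=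
  Real.exp (-∫ u in Ioc 0 t, (intensity lam X Y u ω - 1) ∂leb) *
    ∏ᶠ (u : ℝ≥0) (_ : u ∈ Ioc 0 t), intensity lam X Y u ω ^ jump (Y ω).1 u

/-! ### The unnormalized filter -/

/-- `q` is a version of the process `q_t = E_Q[Z_t X_t | 𝒴_t]` for `t ∈ [0,T]`, adapted to the
observation filtration and with almost surely càdlàg paths. -/
structure IsUnnormalizedFilter (lam : Fin N → ℝ≥0 → CountingPath → ℝ) (X : ℝ≥0 → Ω → Fin N)
    (Y : Ω → CountingPath) (hY : Measurable Y) (Q : Measure Ω) (T : ℝ≥0)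
    (q : ℝ≥0 → Ω → Fin N → ℝ) : Prop where
  adapted : ∀ t ≤ T, StronglyMeasurable[obsFiltration Y hY t] (q t)
  condExp : ∀ t ≤ T,
    q t =ᵐ[Q] Q[fun ω => density lam X Y t ω • basisVec (X t ω) | obsFiltration Y hY t]
  cadlag : ∀ᵐ ω ∂Q, IsCadlagOn (Icc 0 T) fun t => q t ω

/-- The integrand `(Λ_u - I) q_{u-}`. -/
def jumpTerm (lam : Fin N → ℝ≥0 → CountingPath → ℝ) (y : CountingPath)
    (q : ℝ≥0 → Fin N → ℝ) (u : ℝ≥0) : Fin N → ℝ :=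
  (Lam lam u y - 1) *ᵥ Function.leftLim q u

/-- The equation
`q_t = q_0 + ∫_{]0,t]} (Λ_u - I) q_{u-} (dY_u - du) + ∫_{]0,t]} A_u q_u du`, for all `t ∈ [0,T]`,
along one path `q` and one counting path `y`; both Lebesgue integrals are required to converge. -/
def SolvesFilterEquation (A : ℝ≥0 → Matrix (Fin N) (Fin N) ℝ)
    (lam : Fin N → ℝ≥0 → CountingPath → ℝ) (T : ℝ≥0) (y : CountingPath)
    (q : ℝ≥0 → Fin N → ℝ) : Prop :=
  ∀ t ≤ T,
    IntegrableOn (jumpTerm lam y q) (Ioc 0 t) leb ∧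
    IntegrableOn (fun u : ℝ≥0 => A u *ᵥ q u) (Ioc 0 t) leb ∧
    q t = q 0
      + (jumpIntegral y t (jumpTerm lam y q)
          - ∫ u in Ioc 0 t, jumpTerm lam y q u ∂leb)
      + ∫ u in Ioc 0 t, A u *ᵥ q u ∂leb

/-- On `[0,T]`, `P` has density process `Z` with respect to `Q`: `dP/dQ = Z_t` on `𝓕_t`. -/
def HasDensityProcess (P Q : Measure Ω) (𝓕 : Filtration ℝ≥0 m) (T : ℝ≥0)
    (Z : ℝ≥0 → Ω → ℝ) : Prop :=
  ∀ t ≤ T, ∀ B, MeasurableSet[𝓕 t] B → P B = ∫⁻ ω in B, ENNReal.ofReal (Z t ω) ∂Q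

end CountingFilter

end

/-!
The density `Z_t` is a functional of the path of the chain `X` and of the observed path `Y` up to
time `t`, and `X` and `Y` are independent under `Q`. Hence `E_Q[Z_t X_t | 𝒴_t]` is obtained by
holding the observed path `y` fixed and integrating over an independent copy of the chain
(`condExp_decoupled`, `filterVersion_ae_eq_condExp`), and everything reduces to one path `y` at a
time. Along a fixed `y` only finitely many jump times matter, and `X` has finitely many states, so
that `Z` is dominated on `[0,T]` by a constant depending on `y` alone (`weight_le`). By dominated
convergence the resulting version is càdlàg, with left limit `E_Q[Z_{t-} X_{t-}]`
(`cadlag_filterVersion`, `tendsto_pathFilter_left`). It is adapted because the intensities are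
progressively measurable and the jump times of `y` in `]0,t]` are functions of `y` on `[0,t]`
(`measurable_decoupled_weight`).

The equation along a fixed `y` (`pathFilter_equation`) comes from two integral identities. The path
of the density satisfies `Z_t = 1 + ∫_{]0,t]} H_u (dy_u - du)` with `H_u = Z_{u-} (λ_u - 1)`
(`weight_eq_one_add_integral`), and for a variable `H` depending on the chain up to time `u`, the
Kolmogorov equation gives `E[H X_t] = E[H X_u] + ∫_{]u,t]} A_r E[H X_r] dr`
(`IsMarkovChain.integral_mul_stateInd`). Inserting the first identity into `E[Z_t X_t]`, applying
the second one to every `H_u`, and exchanging the integrals in `u` and `r` yields the filter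
equation. No regularity of the transition matrices in their first time argument is needed. The
chain does not jump at a fixed time (`IsMarkovChain.ae_leftLim_eq`), so that `X_u` may be replaced
by the jointly measurable process `X_{u-}` wherever Fubini's theorem is applied, and by the state
`X_{u-}` in which the intensity is evaluated.

Any other càdlàg version is indistinguishable from this one on `[0,T]` (`ae_forall_eq_of_cadlag`)
and therefore satisfies the same equation. The normalized form is Bayes' formula for the change of
measure with density `Z_t` (`bayes_formula`).
-/

noncomputable section

namespace CountingFilter

/-! ### Lebesgue measure on `ℝ≥0` -/

theorem measurableEmbedding_coe : MeasurableEmbedding ((↑) : ℝ≥0 → ℝ) :=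
  MeasurableEmbedding.subtype_coe measurableSet_Ici

theorem map_coe_leb : Measure.map ((↑) : ℝ≥0 → ℝ) leb = volume.restrict (Ici 0) := by
  rw [leb, measurableEmbedding_coe.map_comap]
  exact congrArg _ Subtype.range_coe

theorem leb_apply (s : Set ℝ≥0) : leb s = volume (((↑) : ℝ≥0 → ℝ) '' s) :=
  measurableEmbedding_coe.comap_apply _ _

instance : NullSingletonClass leb := ⟨fun x => by simp [leb_apply]⟩

theorem leb_Ioc (s t : ℝ≥0) : leb (Ioc s t) = ENNReal.ofReal (t - s) := by
  rw [leb_apply, NNReal.image_coe_Ioc, Real.volume_Ioc]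

instance : SigmaFinite leb := by
  have : SigmaFinite (Measure.map ((↑) : ℝ≥0 → ℝ) leb) := by
    rw [map_coe_leb]; infer_instance
  exact SigmaFinite.of_map leb measurableEmbedding_coe.measurable.aemeasurable this

instance isFiniteMeasure_leb_Ioc (s t : ℝ≥0) : IsFiniteMeasure (leb.restrict (Ioc s t)) :=
  ⟨by simp [leb_Ioc]⟩

theorem preimage_coe_Ioc (s t : ℝ≥0) : ((↑) : ℝ≥0 → ℝ) ⁻¹' Ioc (s : ℝ) t = Ioc s t := by
  ext; simp

theorem setIntegral_Ioc_leb {s t : ℝ≥0} (hst : s ≤ t) (f : ℝ≥0 → ℝ) :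
    ∫ u in Ioc s t, f u ∂leb = ∫ x in (s : ℝ)..t, f x.toNNReal := by
  have h : (Ioc (s : ℝ) t) ∩ Ici 0 = Ioc (s : ℝ) t :=
    inter_eq_left.2 fun x hx => s.2.trans hx.1.le
  rw [intervalIntegral.integral_of_le (by exact_mod_cast hst),
    ← h, ← Measure.restrict_restrict measurableSet_Ioc, ← map_coe_leb,
    measurableEmbedding_coe.setIntegral_map, preimage_coe_Ioc]
  simp

theorem integrableOn_Ioc_leb_iff {s t : ℝ≥0} (f : ℝ≥0 → ℝ) :
    IntegrableOn f (Ioc s t) leb ↔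
      IntegrableOn (fun x : ℝ => f x.toNNReal) (Ioc (s : ℝ) t) volume := by
  have h : (Ioc (s : ℝ) t) ∩ Ici 0 = Ioc (s : ℝ) t :=
    inter_eq_left.2 fun x hx => s.2.trans hx.1.le
  rw [← h, IntegrableOn, IntegrableOn, ← Measure.restrict_restrict measurableSet_Ioc,
    ← map_coe_leb, ← IntegrableOn, ← IntegrableOn,
    measurableEmbedding_coe.integrableOn_map_iff, preimage_coe_Ioc]
  simp [Function.comp_def]

theorem absolutelyContinuousOnInterval_comp_of_lipschitzOnWith {f g : ℝ → ℝ} {a b : ℝ} {S : Set ℝ}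
    {K : ℝ≥0} (hf : AbsolutelyContinuousOnInterval f a b) (hS : MapsTo f (uIcc a b) S)
    (hg : LipschitzOnWith K g S) : AbsolutelyContinuousOnInterval (g ∘ f) a b := by
  have h0 : Tendsto (fun E : ℕ × (ℕ → ℝ × ℝ) =>
      (K : ℝ) * ∑ i ∈ Finset.range E.1, dist (f (E.2 i).1) (f (E.2 i).2))
      (AbsolutelyContinuousOnInterval.totalLengthFilter ⊓
        𝓟 (AbsolutelyContinuousOnInterval.disjWithin a b)) (𝓝 0) := by
    simpa using Tendsto.const_mul (K : ℝ) hf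
  refine squeeze_zero' (Eventually.of_forall fun E => Finset.sum_nonneg fun _ _ => dist_nonneg)
    ?_ h0
  filter_upwards [mem_inf_of_right (mem_principal_self _)] with E hE
  rw [Finset.mul_sum]
  exact Finset.sum_le_sum fun i hi =>
    hg.dist_le_mul _ (hS (hE.1 i hi).1) _ (hS (hE.1 i hi).2)

/-- Since `v ↦ exp (-∫_{]0,v]} g)` is absolutely continuous with derivative
`v ↦ -g v exp (-∫_{]0,v]} g)` almost everywhere, it is the primitive of this derivative. -/
theorem exp_neg_integral_sub {g : ℝ≥0 → ℝ} {T s t : ℝ≥0} (hg : IntegrableOn g (Ioc 0 T) leb)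
    (hst : s ≤ t) (htT : t ≤ T) :
    Real.exp (-∫ u in Ioc 0 t, g u ∂leb) = Real.exp (-∫ u in Ioc 0 s, g u ∂leb)
      - ∫ u in Ioc s t, Real.exp (-∫ v in Ioc 0 u, g v ∂leb) * g u ∂leb := by
  set g' : ℝ → ℝ := fun x => g x.toNNReal with hg'
  have hst' : (s : ℝ) ≤ t := by exact_mod_cast hst
  have h0t : (0 : ℝ) ≤ t := t.2
  have hint : IntervalIntegrable g' volume 0 t := by
    rw [intervalIntegrable_iff_integrableOn_Ioc_of_le h0t]
    have := (integrableOn_Ioc_leb_iff (s := 0) (t := t) g).1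
      (hg.mono_set (Ioc_subset_Ioc_right htT))
    simpa using this
  set G : ℝ → ℝ := fun x => -∫ y in (0 : ℝ)..x, g' y with hG
  have hGac : AbsolutelyContinuousOnInterval G 0 t :=
    (hint.absolutelyContinuousOnInterval_intervalIntegral (c := 0) (by simp)).neg
  obtain ⟨M, hM⟩ := hGac.exists_bound
  have hlip : LipschitzOnWith (Real.exp M).toNNReal Real.exp (Iic M) := by
    refine Convex.lipschitzOnWith_of_nnnorm_deriv_le (fun x _ => Real.differentiableAt_exp)
      (fun x hx => ?_) (convex_Iic M)
    rw [← NNReal.coe_le_coe]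
    simpa [Real.exp_nonneg] using hx
  have hac : AbsolutelyContinuousOnInterval (Real.exp ∘ G) 0 t :=
    absolutelyContinuousOnInterval_comp_of_lipschitzOnWith hGac (S := Iic M)
      (fun x hx => (le_abs_self _).trans (hM x hx)) hlip
  have hsub : uIcc (s : ℝ) t ⊆ uIcc 0 (t : ℝ) := by
    rw [uIcc_of_le hst', uIcc_of_le h0t]; exact Icc_subset_Icc_left s.2
  have hftc := (hac.mono hsub).integral_deriv_eq_sub
  have hGcoe : ∀ u : ℝ≥0, ∫ v in Ioc 0 u, g v ∂leb = -G u := by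
    intro u
    rw [setIntegral_Ioc_leb zero_le]
    simp [hG, hg']
  rw [setIntegral_Ioc_leb hst]
  simp only [hGcoe, neg_neg]
  have hcongr : ∫ x in (s : ℝ)..t, deriv (Real.exp ∘ G) x
      = ∫ x in (s : ℝ)..t, -(Real.exp (G x.toNNReal) * g x.toNNReal) := by
    refine intervalIntegral.integral_congr_ae ?_
    filter_upwards [hint.ae_hasDerivAt_integral] with x hx hxm
    have hx0 : 0 ≤ x := by
      rw [uIoc_of_le hst'] at hxm
      exact s.2.trans hxm.1.le
    have hd := (hx (hsub (uIoc_subset_uIcc hxm)) 0 (by simp)).neg.exp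
    have : deriv (Real.exp ∘ G) x = Real.exp (G x) * -g' x := hd.deriv
    rw [this, Real.coe_toNNReal x hx0, mul_neg]
  rw [hcongr, intervalIntegral.integral_neg] at hftc
  simp only [Function.comp] at hftc
  linarith

/-! ### The weight along a single path -/

/-- The factor `exp (-∫_{]0,t]} (κ_u - 1) du` of the density along one path `κ` of the intensity. -/
def expWeight (κ : ℝ≥0 → ℝ) (t : ℝ≥0) : ℝ := Real.exp (-∫ u in Ioc 0 t, (κ u - 1) ∂leb)

/-- The density at time `t` along one path `κ` of the intensity and one finite set `J` of
observed jump times. -/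
def weight (κ : ℝ≥0 → ℝ) (J : Finset ℝ≥0) (t : ℝ≥0) : ℝ :=
  expWeight κ t * ∏ s ∈ J with s ≤ t, κ s

/-- The left limit at `t` of the path `weight κ J`. -/
def leftWeight (κ : ℝ≥0 → ℝ) (J : Finset ℝ≥0) (t : ℝ≥0) : ℝ :=
  expWeight κ t * ∏ s ∈ J with s < t, κ s

/-- The measure `du + ∑_{s ∈ J} δ_s` on `]0,T]`: the total variation of the compensated
counting path with jump times `J`. -/
def drive (J : Finset ℝ≥0) (T : ℝ≥0) : Measure ℝ≥0 :=
  leb.restrict (Ioc 0 T) + ∑ s ∈ J, Measure.dirac s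

/-- The density of the signed measure `dy_u - du` with respect to `drive J T`. -/
def driveSign (J : Finset ℝ≥0) (u : ℝ≥0) : ℝ := if u ∈ J then 1 else -1

/-- The integrand of the density in the equation `dZ = H (dy - du)`. -/
def weightTerm (κ : ℝ≥0 → ℝ) (J : Finset ℝ≥0) (u : ℝ≥0) : ℝ := leftWeight κ J u * (κ u - 1)

theorem measurable_driveSign (J : Finset ℝ≥0) : Measurable (driveSign J) :=
  Measurable.ite J.measurableSet measurable_const measurable_const

theorem abs_driveSign (J : Finset ℝ≥0) (u : ℝ≥0) : |driveSign J u| = 1 := by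
  unfold driveSign; split_ifs <;> simp

instance (J : Finset ℝ≥0) (T : ℝ≥0) : IsFiniteMeasure (drive J T) := by
  refine ⟨?_⟩
  simp [drive, leb_Ioc]

theorem integrable_drive_iff {E : Type*} [NormedAddCommGroup E] {J : Finset ℝ≥0} {T : ℝ≥0}
    {f : ℝ≥0 → E} : Integrable f (drive J T) ↔ IntegrableOn f (Ioc 0 T) leb := by
  rw [drive, integrable_add_measure, integrable_finsetSum_measure]
  exact and_iff_left fun s _ => integrable_dirac (by simp)

theorem ae_leb_notMem (J : Finset ℝ≥0) : ∀ᵐ u ∂leb, u ∉ J :=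
  measure_eq_zero_iff_ae_notMem.1 (J.finite_toSet.measure_zero leb)

theorem integral_drive {E : Type*} [NormedAddCommGroup E] [NormedSpace ℝ E] [CompleteSpace E]
    {J : Finset ℝ≥0} {T : ℝ≥0}
    {f : ℝ≥0 → E} (hf : IntegrableOn f (Ioc 0 T) leb) :
    ∫ u, f u ∂drive J T = ∫ u in Ioc 0 T, f u ∂leb + ∑ s ∈ J, f s := by
  have h : ∀ s ∈ J, Integrable f (Measure.dirac s) := fun s _ => integrable_dirac (by simp)
  rw [drive, integral_add_measure hf ((integrable_finsetSum_measure).2 h),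
    integral_finsetSum_measure h]
  simp

theorem setIntegral_drive_sign {E : Type*} [NormedAddCommGroup E] [NormedSpace ℝ E]
    [CompleteSpace E] {J : Finset ℝ≥0} {T : ℝ≥0} (hJ : ∀ s ∈ J, s ∈ Ioc 0 T)
    {f : ℝ≥0 → E} (hf : IntegrableOn f (Ioc 0 T) leb) {t : ℝ≥0} (ht : t ≤ T) :
    ∫ u in Ioc 0 t, driveSign J u • f u ∂drive J T
      = ∑ s ∈ J with s ≤ t, f s - ∫ u in Ioc 0 t, f u ∂leb := by
  have hf' : IntegrableOn (fun u => driveSign J u • f u) (Ioc 0 T) leb := by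
    refine Integrable.bdd_smul hf 1 (measurable_driveSign J).aestronglyMeasurable
      (ae_of_all _ fun u => by simp [abs_driveSign])
  rw [← integral_indicator measurableSet_Ioc,
    integral_drive (hf'.indicator measurableSet_Ioc), setIntegral_indicator measurableSet_Ioc,
    inter_eq_right.2 (Ioc_subset_Ioc_right ht), sub_eq_add_neg, add_comm, Finset.sum_filter,
    ← integral_neg]
  congr 1
  · refine Finset.sum_congr rfl fun s hs => ?_
    by_cases h : s ≤ t
    · rw [indicator_of_mem (mem_Ioc.2 ⟨(hJ s hs).1, h⟩)]
      simp [h, driveSign, hs]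
    · simp [h]
  · refine integral_congr_ae (ae_restrict_of_ae ?_)
    filter_upwards [ae_leb_notMem J] with u hu
    simp [driveSign, hu]

theorem expWeight_pos (κ : ℝ≥0 → ℝ) (t : ℝ≥0) : 0 < expWeight κ t := Real.exp_pos _

section PathBounds

variable {κ : ℝ≥0 → ℝ} {J : Finset ℝ≥0} {T : ℝ≥0}

theorem integrableOn_sub_one (hint : IntegrableOn κ (Ioc 0 T) leb) :
    IntegrableOn (fun u => κ u - 1) (Ioc 0 T) leb :=
  hint.sub (integrable_const 1)

theorem continuousOn_expWeight (hint : IntegrableOn κ (Ioc 0 T) leb) :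
    ContinuousOn (expWeight κ) (Icc 0 T) := by
  have h1 : IntegrableOn (fun x : ℝ => κ x.toNNReal - 1) (uIcc 0 (T : ℝ)) volume := by
    rw [uIcc_of_le T.coe_nonneg, integrableOn_Icc_iff_integrableOn_Ioc]
    simpa using (integrableOn_Ioc_leb_iff (s := 0) (t := T) _).1 (integrableOn_sub_one hint)
  have h2 := (intervalIntegral.continuousOn_primitive_interval h1).comp
    (NNReal.continuous_coe.continuousOn (s := Icc 0 T))
    (fun u hu => by rw [uIcc_of_le T.coe_nonneg]; exact ⟨u.2, by exact_mod_cast hu.2⟩)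
  refine (h2.neg.rexp).congr fun u _ => ?_
  rw [expWeight, setIntegral_Ioc_leb zero_le]
  simp

theorem expWeight_le (hpos : ∀ u, 0 < κ u) (hint : IntegrableOn κ (Ioc 0 T) leb)
    {t : ℝ≥0} (ht : t ≤ T) : expWeight κ t ≤ Real.exp T := by
  refine Real.exp_le_exp.2 ?_
  have h1 : IntegrableOn κ (Ioc 0 t) leb := hint.mono_set (Ioc_subset_Ioc_right ht)
  rw [integral_sub h1 (integrable_const 1)]
  have h2 : 0 ≤ ∫ u in Ioc 0 t, κ u ∂leb := integral_nonneg fun u => (hpos u).le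
  have h3 : ∫ _ in Ioc 0 t, (1 : ℝ) ∂leb = t := by simp [measureReal_def, leb_Ioc]
  have h4 : (t : ℝ) ≤ T := by exact_mod_cast ht
  linarith

theorem prod_filter_le {b : ℝ≥0 → ℝ} (hpos : ∀ u, 0 < κ u) (hb : ∀ s ∈ J, κ s ≤ b s)
    (p : ℝ≥0 → Prop) [DecidablePred p] :
    ∏ s ∈ J with p s, κ s ≤ ∏ s ∈ J, max 1 (b s) := by
  rw [Finset.prod_filter]
  refine Finset.prod_le_prod (fun s _ => by split_ifs <;> simp [(hpos s).le]) fun s hs => ?_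
  split_ifs
  · exact (hb s hs).trans (le_max_right _ _)
  · exact le_max_left _ _

theorem one_le_prod_max (J : Finset ℝ≥0) (b : ℝ≥0 → ℝ) : 1 ≤ ∏ s ∈ J, max 1 (b s) :=
  Finset.one_le_prod fun _ _ => le_max_left _ _

theorem prod_filter_pos (hpos : ∀ u, 0 < κ u) (p : ℝ≥0 → Prop) [DecidablePred p] :
    0 < ∏ s ∈ J with p s, κ s := Finset.prod_pos fun s _ => hpos s

theorem weight_nonneg (hpos : ∀ u, 0 < κ u) (t : ℝ≥0) : 0 ≤ weight κ J t :=
  (mul_pos (expWeight_pos _ _) (prod_filter_pos hpos _)).le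

theorem leftWeight_nonneg (hpos : ∀ u, 0 < κ u) (t : ℝ≥0) : 0 ≤ leftWeight κ J t :=
  (mul_pos (expWeight_pos _ _) (prod_filter_pos hpos _)).le

/-- A bound for the weight up to time `T` in terms of bounds for the intensity at the jump times
alone. -/
def weightBound (J : Finset ℝ≥0) (b : ℝ≥0 → ℝ) (T : ℝ≥0) : ℝ :=
  Real.exp T * ∏ s ∈ J, max 1 (b s)

theorem weightBound_nonneg (J : Finset ℝ≥0) (b : ℝ≥0 → ℝ) (T : ℝ≥0) : 0 ≤ weightBound J b T :=
  mul_nonneg (Real.exp_nonneg _) (zero_le_one.trans (one_le_prod_max J b))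

theorem weight_le {b : ℝ≥0 → ℝ} (hpos : ∀ u, 0 < κ u) (hint : IntegrableOn κ (Ioc 0 T) leb)
    (hb : ∀ s ∈ J, κ s ≤ b s) {t : ℝ≥0} (ht : t ≤ T) : weight κ J t ≤ weightBound J b T :=
  mul_le_mul (expWeight_le hpos hint ht) (prod_filter_le hpos hb _) (prod_filter_pos hpos _).le
    (Real.exp_nonneg _)

theorem leftWeight_le {b : ℝ≥0 → ℝ} (hpos : ∀ u, 0 < κ u) (hint : IntegrableOn κ (Ioc 0 T) leb)
    (hb : ∀ s ∈ J, κ s ≤ b s) {t : ℝ≥0} (ht : t ≤ T) : leftWeight κ J t ≤ weightBound J b T :=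
  mul_le_mul (expWeight_le hpos hint ht) (prod_filter_le hpos hb _) (prod_filter_pos hpos _).le
    (Real.exp_nonneg _)

theorem tendsto_weight_right (hint : IntegrableOn κ (Ioc 0 T) leb) {t : ℝ≥0} (ht : t ∈ Icc 0 T) :
    Tendsto (weight κ J) (𝓝[Icc 0 T ∩ Ici t] t) (𝓝 (weight κ J t)) := by
  refine ((continuousOn_expWeight hint t ht).mono_left
    (nhdsWithin_mono _ inter_subset_left)).mul (tendsto_const_nhds.congr' ?_)
  have h : ∀ᶠ u in 𝓝[Icc 0 T ∩ Ici t] t, ∀ s ∈ J, t < s → u < s :=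
    (Finset.eventually_all J).2 fun s _ => by
      by_cases hs : t < s
      · filter_upwards [mem_nhdsWithin_of_mem_nhds (Iio_mem_nhds hs)] with u hu _ using hu
      · exact Eventually.of_forall fun u h => absurd h hs
  filter_upwards [h, self_mem_nhdsWithin] with u hu hut
  refine Finset.prod_congr (Finset.filter_congr fun s hs => ?_) fun _ _ => rfl
  exact ⟨fun h => h.trans hut.2, fun h => not_lt.1 fun h' => (hu s hs h').not_ge h⟩

theorem tendsto_weight_left (hint : IntegrableOn κ (Ioc 0 T) leb) {t : ℝ≥0} (ht : t ∈ Icc 0 T) :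
    Tendsto (weight κ J) (𝓝[Icc 0 T ∩ Iio t] t) (𝓝 (leftWeight κ J t)) := by
  refine ((continuousOn_expWeight hint t ht).mono_left
    (nhdsWithin_mono _ inter_subset_left)).mul (tendsto_const_nhds.congr' ?_)
  have h : ∀ᶠ u in 𝓝[Icc 0 T ∩ Iio t] t, ∀ s ∈ J, s < t → s < u :=
    (Finset.eventually_all J).2 fun s _ => by
      by_cases hs : s < t
      · filter_upwards [mem_nhdsWithin_of_mem_nhds (Ioi_mem_nhds hs)] with u hu _ using hu
      · exact Eventually.of_forall fun u h => absurd h hs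
  filter_upwards [h, self_mem_nhdsWithin] with u hu hut
  refine Finset.prod_congr (Finset.filter_congr fun s hs => ?_) fun _ _ => rfl
  exact ⟨fun h => (hu s hs h).le, fun h => h.trans_lt hut.2⟩

/-- Telescoping of a product over an initial segment of `J`. -/
theorem prod_eq_one_add_sum (κ : ℝ≥0 → ℝ) (J : Finset ℝ≥0) (p : ℝ≥0 → Prop) [DecidablePred p]
    (hp : ∀ r s, r ≤ s → p s → p r) :
    ∏ s ∈ J with p s, κ s = 1 + ∑ s ∈ J with p s, (∏ r ∈ J with r < s, κ r) * (κ s - 1) := by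
  have h := Finset.prod_add_ordered {s ∈ J | p s} (fun _ => (1 : ℝ)) (fun s => κ s - 1)
  simp only [add_sub_cancel, Finset.prod_const_one, mul_one] at h
  rw [h]
  congr 1
  refine Finset.sum_congr rfl fun s hs => ?_
  rw [mul_comm, Finset.filter_filter]
  congr 2
  refine Finset.filter_congr fun r _ => ?_
  exact ⟨fun h => h.2, fun h => ⟨hp r s h.le (Finset.mem_filter.1 hs).2, h⟩⟩

theorem integrableOn_expWeight_mul {g : ℝ≥0 → ℝ} (hint : IntegrableOn κ (Ioc 0 T) leb)
    (hpos : ∀ u, 0 < κ u)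
    (hg : IntegrableOn g (Ioc 0 T) leb) :
    IntegrableOn (fun u => expWeight κ u * g u) (Ioc 0 T) leb := by
  refine Integrable.bdd_mul (c := Real.exp T) hg
    (((continuousOn_expWeight hint).mono Ioc_subset_Icc_self).aestronglyMeasurable
      measurableSet_Ioc) ?_
  filter_upwards [ae_restrict_mem measurableSet_Ioc] with u hu
  rw [Real.norm_of_nonneg (expWeight_pos _ _).le]
  exact expWeight_le hpos hint hu.2

theorem expWeight_sub (hint : IntegrableOn κ (Ioc 0 T) leb) {s t : ℝ≥0} (hst : s ≤ t)
    (ht : t ≤ T) :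
    ∫ u in Ioc s t, expWeight κ u * (κ u - 1) ∂leb = expWeight κ s - expWeight κ t := by
  have := exp_neg_integral_sub (integrableOn_sub_one hint) hst ht
  simp only [expWeight]
  linarith

theorem measurable_leftWeight_prod (κ : ℝ≥0 → ℝ) (J : Finset ℝ≥0) :
    Measurable fun u : ℝ≥0 => ∏ s ∈ J with s < u, κ s := by
  simp only [Finset.prod_filter]
  exact Finset.measurable_fun_prod _ fun s _ =>
    Measurable.ite measurableSet_Ioi measurable_const measurable_const

theorem integrableOn_weightTerm {b : ℝ≥0 → ℝ} (hpos : ∀ u, 0 < κ u)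
    (hint : IntegrableOn κ (Ioc 0 T) leb) (hb : ∀ s ∈ J, κ s ≤ b s) :
    IntegrableOn (weightTerm κ J) (Ioc 0 T) leb := by
  have h := integrableOn_expWeight_mul hint hpos (integrableOn_sub_one hint)
  have := Integrable.bdd_mul (c := ∏ s ∈ J, max 1 (b s)) h
    (measurable_leftWeight_prod κ J).aestronglyMeasurable (ae_of_all _ fun u => by
      rw [Real.norm_of_nonneg (prod_filter_pos hpos _).le]
      exact prod_filter_le hpos hb _)
  refine this.congr (ae_of_all _ fun u => ?_)
  simp only [weightTerm, leftWeight]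
  ring

/-- The integral form of `dZ = Z₋ (κ - 1) (dy - du)`. -/
theorem weight_eq_one_add_integral (hpos : ∀ u, 0 < κ u) (hint : IntegrableOn κ (Ioc 0 T) leb)
    (hJ : ∀ s ∈ J, s ∈ Ioc 0 T) {t : ℝ≥0} (ht : t ≤ T) :
    weight κ J t = 1 + ∫ u in Ioc 0 t, driveSign J u * weightTerm κ J u ∂drive J T := by
  have hH := integrableOn_weightTerm (b := κ) (J := J) hpos hint fun _ _ => le_rfl
  have hdrive := setIntegral_drive_sign hJ hH ht
  simp only [smul_eq_mul] at hdrive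
  rw [hdrive]
  -- `D s` is the jump at `s` of the product part; expanding that part into its jumps leaves only
  -- integrals of the exponential part over intervals `]s,t]`
  set D : ℝ≥0 → ℝ := fun s => (∏ r ∈ J with r < s, κ r) * (κ s - 1) with hD
  have hg : IntegrableOn (fun u => expWeight κ u * (κ u - 1)) (Ioc 0 T) leb :=
    integrableOn_expWeight_mul hint hpos (integrableOn_sub_one hint)
  have hgt := hg.mono_set (Ioc_subset_Ioc_right ht)
  have hleb : ∫ u in Ioc 0 t, weightTerm κ J u ∂leb
      = (1 - expWeight κ t) + ∑ s ∈ J with s ≤ t, D s * (expWeight κ s - expWeight κ t) := by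
    have h1 : ∫ u in Ioc 0 t, weightTerm κ J u ∂leb
        = ∫ u in Ioc 0 t, (expWeight κ u * (κ u - 1) + ∑ s ∈ J with s ≤ t,
            D s * (Ioc s t).indicator (fun u => expWeight κ u * (κ u - 1)) u) ∂leb := by
      refine setIntegral_congr_fun measurableSet_Ioc fun u hu => ?_
      simp only [weightTerm, leftWeight]
      rw [prod_eq_one_add_sum κ J (· < u) fun r s h h' => h.trans_lt h', mul_add, mul_one, add_mul]
      congr 1
      rw [Finset.sum_filter, Finset.sum_filter, Finset.mul_sum, Finset.sum_mul]
      refine Finset.sum_congr rfl fun s _ => ?_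
      by_cases h : s < u
      · rw [if_pos h, if_pos (h.le.trans hu.2), indicator_of_mem (mem_Ioc.2 ⟨h, hu.2⟩)]
        simp only [hD]; ring
      · rw [if_neg h, indicator_of_notMem (fun h' => h h'.1)]
        simp
    have hi : ∀ s : ℝ≥0, IntegrableOn
        (fun u => D s * (Ioc s t).indicator (fun u => expWeight κ u * (κ u - 1)) u)
        (Ioc 0 t) leb := fun s => (hgt.indicator measurableSet_Ioc).const_mul _
    rw [h1, integral_add hgt (integrable_finsetSum _ fun s _ => hi s),
      integral_finsetSum _ fun s _ => hi s, expWeight_sub hint zero_le ht]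
    congr 1
    · simp [expWeight]
    · refine Finset.sum_congr rfl fun s hs => ?_
      rw [integral_const_mul, setIntegral_indicator measurableSet_Ioc,
        inter_eq_right.2 (Ioc_subset_Ioc_left zero_le),
        expWeight_sub hint (Finset.mem_filter.1 hs).2 ht]
  rw [hleb, weight, prod_eq_one_add_sum κ J (· ≤ t) fun r s h h' => h.trans h']
  have h2 : ∑ s ∈ J with s ≤ t, weightTerm κ J s = ∑ s ∈ J with s ≤ t, expWeight κ s * D s :=
    Finset.sum_congr rfl fun s _ => by simp only [weightTerm, leftWeight, hD]; ring
  rw [h2]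
  have h4 : ∑ s ∈ J with s ≤ t, D s * (expWeight κ s - expWeight κ t)
      = ∑ s ∈ J with s ≤ t, D s * expWeight κ s
        - (∑ s ∈ J with s ≤ t, D s) * expWeight κ t := by
    simp only [mul_sub, Finset.sum_sub_distrib, ← Finset.sum_mul]
  have h3 : ∑ s ∈ J with s ≤ t, expWeight κ s * D s = ∑ s ∈ J with s ≤ t, D s * expWeight κ s :=
    Finset.sum_congr rfl fun s _ => mul_comm _ _
  rw [h3, h4]
  ring

/-- The total variation of the weight on `]0,T]` is bounded in terms of bounds for the intensity
at the jump times alone: between jumps, `Z κ du = Z du - dZ`. -/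
theorem integral_abs_weightTerm_le {b : ℝ≥0 → ℝ} (hpos : ∀ u, 0 < κ u)
    (hint : IntegrableOn κ (Ioc 0 T) leb) (hb : ∀ s ∈ J, κ s ≤ b s)
    (hJ : ∀ s ∈ J, s ∈ Ioc 0 T) :
    ∫ u, |weightTerm κ J u| ∂drive J T ≤
      (∏ s ∈ J, max 1 (b s)) * (1 + 2 * (Real.exp T * T))
        + ∑ s ∈ J, weightBound J b T * (b s + 1) := by
  have hH := integrableOn_weightTerm hpos hint hb
  rw [integral_drive hH.abs]
  set B := ∏ s ∈ J, max 1 (b s)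
  have hB : 0 ≤ B := zero_le_one.trans (one_le_prod_max J b)
  have habs : ∀ s, |κ s - 1| ≤ κ s + 1 := fun s => by
    rw [abs_le]; constructor <;> linarith [hpos s]
  refine add_le_add ?_ (Finset.sum_le_sum fun s hs => ?_)
  · have hg : IntegrableOn (fun u => expWeight κ u * (κ u - 1)) (Ioc 0 T) leb :=
      integrableOn_expWeight_mul hint hpos (integrableOn_sub_one hint)
    have hE : IntegrableOn (fun _ => Real.exp T) (Ioc 0 T) leb := integrable_const _
    calc ∫ u in Ioc 0 T, |weightTerm κ J u| ∂leb
        ≤ ∫ u in Ioc 0 T, B * (expWeight κ u * (κ u - 1) + 2 * Real.exp T) ∂leb := by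
          refine setIntegral_mono_on hH.abs ((hg.add (hE.const_mul 2)).const_mul B)
            measurableSet_Ioc fun u hu => ?_
          have h1 := expWeight_le hpos hint hu.2
          have h2 := expWeight_pos κ u
          have h3 : ∏ s ∈ J with s < u, κ s ≤ B := prod_filter_le hpos hb _
          have h4 : 0 < ∏ s ∈ J with s < u, κ s := prod_filter_pos hpos _
          rw [weightTerm, abs_mul, abs_of_nonneg (leftWeight_nonneg hpos u), leftWeight]
          calc expWeight κ u * (∏ s ∈ J with s < u, κ s) * |κ u - 1|
              ≤ expWeight κ u * B * (κ u + 1) := by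
                gcongr
                exact habs u
            _ = B * (expWeight κ u * (κ u - 1) + 2 * expWeight κ u) := by ring
            _ ≤ _ := by gcongr
      _ = B * ((1 - expWeight κ T) + 2 * (Real.exp T * T)) := by
          rw [integral_const_mul, integral_add hg (hE.const_mul 2),
            expWeight_sub hint zero_le le_rfl]
          simp [expWeight, measureReal_def, leb_Ioc]
          ring_nf
          simp
      _ ≤ _ := by
          gcongr
          linarith [expWeight_pos κ T]
  · rw [weightTerm, abs_mul, abs_of_nonneg (leftWeight_nonneg hpos s)]
    refine mul_le_mul (leftWeight_le hpos hint hb (hJ s hs).2) ?_ (abs_nonneg _)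
      (weightBound_nonneg J b T)
    linarith [habs s, hb s hs]

end PathBounds

/-! ### Left limits of càdlàg paths -/

theorem IsCadlagOn.tendsto_leftLim {E : Type*} [TopologicalSpace E] {f : ℝ≥0 → E}
    (hf : IsCadlagOn univ f) (t : ℝ≥0) :
    Tendsto f (𝓝[<] t) (𝓝 (Function.leftLim f t)) := by
  obtain ⟨l, hl⟩ := (hf t (mem_univ t)).2
  rw [univ_inter] at hl
  exact tendsto_leftLim_of_tendsto ⟨l, hl⟩

theorem leftLim_zero {E : Type*} [TopologicalSpace E] (f : ℝ≥0 → E) :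
    Function.leftLim f 0 = f 0 :=
  leftLim_eq_of_isBot fun _ => zero_le

theorem nhdsLT_neBot_of_pos {t : ℝ≥0} (h : 0 < t) : (𝓝[<] t).NeBot :=
  nhdsLT_neBot_of_exists_lt ⟨0, h⟩

/-- The largest point of the grid `ℕ / (n + 1)` strictly below `u` (and `0` for `u = 0`). -/
def gridBelow (n : ℕ) (u : ℝ≥0) : ℝ≥0 := ((⌈(n + 1 : ℝ≥0) * u⌉₊ - 1 : ℕ) : ℝ≥0) / (n + 1)

theorem gridBelow_zero (n : ℕ) : gridBelow n 0 = 0 := by simp [gridBelow]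

theorem gridBelow_lt (n : ℕ) {u : ℝ≥0} (hu : 0 < u) : gridBelow n u < u := by
  have h0 : (0 : ℝ≥0) < n + 1 := by positivity
  rw [gridBelow, div_lt_iff₀ h0, mul_comm u]
  have h1 : 0 < ⌈(n + 1 : ℝ≥0) * u⌉₊ := Nat.ceil_pos.2 (by positivity)
  exact Nat.lt_ceil.1 (Nat.sub_lt h1 one_pos)

theorem gridBelow_le (n : ℕ) (u : ℝ≥0) : gridBelow n u ≤ u := by
  rcases eq_zero_or_pos u with rfl | hu
  · rw [gridBelow_zero]
  · exact (gridBelow_lt n hu).le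

theorem le_gridBelow_add (n : ℕ) (u : ℝ≥0) : u ≤ gridBelow n u + 1 / (n + 1) := by
  have h0 : (0 : ℝ≥0) < n + 1 := by positivity
  rw [gridBelow, ← add_div, le_div_iff₀ h0, mul_comm]
  refine (Nat.le_ceil _).trans ?_
  exact_mod_cast Nat.le_add_of_sub_le le_rfl

theorem tendsto_gridBelow {u : ℝ≥0} (hu : 0 < u) :
    Tendsto (fun n => gridBelow n u) atTop (𝓝[<] u) := by
  refine tendsto_nhdsWithin_iff.2 ⟨?_, Eventually.of_forall fun n => gridBelow_lt n hu⟩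
  rw [← NNReal.tendsto_coe]
  have h1 : Tendsto (fun n : ℕ => (u : ℝ) - 1 / ((n : ℝ) + 1)) atTop (𝓝 u) := by
    simpa using tendsto_one_div_add_atTop_nhds_zero_nat.const_sub (u : ℝ)
  refine tendsto_of_tendsto_of_tendsto_of_le_of_le h1 tendsto_const_nhds (fun n => ?_)
    fun n => NNReal.coe_le_coe.2 (gridBelow_le n u)
  have := NNReal.coe_le_coe.2 (le_gridBelow_add n u)
  push_cast at this
  simp only
  linarith

/-- The left-limit process of a process with càdlàg paths is jointly measurable; evaluated at the
times `φ u`, only the values of the process at times below some `φ u` matter. -/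
theorem measurable_leftLim_comp {Ω E : Type*} [MeasurableSpace Ω] [TopologicalSpace E]
    [TopologicalSpace.PseudoMetrizableSpace E] [MeasurableSpace E] [BorelSpace E]
    {X : ℝ≥0 → Ω → E} (hcad : ∀ ω, IsCadlagOn univ fun t => X t ω)
    {φ : ℝ≥0 → ℝ≥0} (hφ : Measurable φ) (hX : ∀ u s, s ≤ φ u → Measurable (X s)) :
    Measurable fun p : ℝ≥0 × Ω => Function.leftLim (fun s => X s p.2) (φ p.1) := by
  classical
  have hlim : ∀ p : ℝ≥0 × Ω, Tendsto (fun n => X (gridBelow n (φ p.1)) p.2) atTop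
      (𝓝 (Function.leftLim (fun s => X s p.2) (φ p.1))) := by
    intro p
    rcases eq_zero_or_pos (φ p.1) with h | h
    · rw [h, leftLim_zero]
      simpa only [gridBelow_zero] using tendsto_const_nhds
    · exact ((hcad p.2).tendsto_leftLim _).comp (tendsto_gridBelow h)
  refine measurable_of_tendsto_metrizable (fun n => ?_) (tendsto_pi_nhds.2 hlim)
  set F : ℕ → Ω → E := fun k =>
    X (if ∃ u, (k : ℝ≥0) / (n + 1) ≤ φ u then (k : ℝ≥0) / (n + 1) else 0) with hF
  have hFm : Measurable (Function.uncurry F) := by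
    refine measurable_from_prod_countable_right fun k => ?_
    simp only [Function.uncurry, hF]
    split_ifs with h
    · obtain ⟨u, hu⟩ := h
      exact hX u _ hu
    · exact hX 0 0 zero_le
  have hk : Measurable fun p : ℝ≥0 × Ω => ((⌈(n + 1 : ℝ≥0) * φ p.1⌉₊ - 1 : ℕ), p.2) := by
    refine Measurable.prodMk ?_ measurable_snd
    have h1 : Measurable fun p : ℝ≥0 × Ω => (n + 1 : ℝ≥0) * φ p.1 :=
      (hφ.comp measurable_fst).const_mul _
    exact (measurable_of_countable (fun k : ℕ => k - 1)).comp (Nat.measurable_ceil.comp h1)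
  convert! hFm.comp hk using 1
  funext p
  have : ∃ u, (((⌈(n + 1 : ℝ≥0) * φ p.1⌉₊ - 1 : ℕ) : ℝ≥0) / (n + 1)) ≤ φ u :=
    ⟨p.1, gridBelow_le n _⟩
  simp only [Function.comp, Function.uncurry, hF, if_pos this, gridBelow]

/-! ### Joint measurability of the weight -/

section Measurability

variable {Ω : Type*} [MeasurableSpace Ω] {κ : Ω → ℝ≥0 → ℝ}

theorem measurable_expWeight (hκ : Measurable fun p : ℝ≥0 × Ω => κ p.2 p.1) :
    Measurable fun p : ℝ≥0 × Ω => expWeight (κ p.2) p.1 := by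
  have h1 : Measurable fun q : (ℝ≥0 × Ω) × ℝ≥0 =>
      (Ioc 0 q.1.1).indicator (fun u => κ q.1.2 u - 1) q.2 := by
    have hs : MeasurableSet {q : (ℝ≥0 × Ω) × ℝ≥0 | q.2 ∈ Ioc 0 q.1.1} := by
      have h0 : MeasurableSet {q : (ℝ≥0 × Ω) × ℝ≥0 | 0 < q.2} :=
        measurableSet_lt measurable_const measurable_snd
      have h1 : MeasurableSet {q : (ℝ≥0 × Ω) × ℝ≥0 | q.2 ≤ q.1.1} :=
        measurableSet_le measurable_snd (measurable_fst.comp measurable_fst)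
      exact h0.inter h1
    have h2 : Measurable fun q : (ℝ≥0 × Ω) × ℝ≥0 => κ q.1.2 q.2 - 1 :=
      (hκ.comp (measurable_snd.prodMk measurable_fst.snd)).sub_const 1
    exact h2.indicator hs
  have h2 := (h1.stronglyMeasurable.integral_prod_right' (ν := leb)).measurable
  convert! Real.measurable_exp.comp h2.neg using 1
  funext p
  simp only [Function.comp, expWeight, Pi.neg_apply, integral_indicator measurableSet_Ioc]

theorem measurable_leftWeight (hκ : Measurable fun p : ℝ≥0 × Ω => κ p.2 p.1) (J : Finset ℝ≥0) :
    Measurable fun p : ℝ≥0 × Ω => leftWeight (κ p.2) J p.1 := by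
  refine (measurable_expWeight hκ).mul ?_
  simp only [Finset.prod_filter]
  exact Finset.measurable_fun_prod _ fun s _ =>
    Measurable.ite (measurableSet_lt measurable_const measurable_fst)
      (hκ.comp (measurable_const.prodMk measurable_snd)) measurable_const

theorem measurable_weight (hκ : Measurable fun p : ℝ≥0 × Ω => κ p.2 p.1) (J : Finset ℝ≥0) :
    Measurable fun p : ℝ≥0 × Ω => weight (κ p.2) J p.1 := by
  refine (measurable_expWeight hκ).mul ?_
  simp only [Finset.prod_filter]
  exact Finset.measurable_fun_prod _ fun s _ =>
    Measurable.ite (measurableSet_le measurable_const measurable_fst)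
      (hκ.comp (measurable_const.prodMk measurable_snd)) measurable_const

theorem measurable_weightTerm (hκ : Measurable fun p : ℝ≥0 × Ω => κ p.2 p.1) (J : Finset ℝ≥0) :
    Measurable fun p : ℝ≥0 × Ω => weightTerm (κ p.2) J p.1 :=
  (measurable_leftWeight hκ J).mul (hκ.sub_const 1)

end Measurability

theorem expWeight_congr {κ κ' : ℝ≥0 → ℝ} {t : ℝ≥0} (h : ∀ u ≤ t, κ u = κ' u) :
    expWeight κ t = expWeight κ' t := by
  rw [expWeight, expWeight]
  congr 2
  exact setIntegral_congr_fun measurableSet_Ioc fun u hu => by rw [h u hu.2]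

theorem weightTerm_congr {κ κ' : ℝ≥0 → ℝ} {t : ℝ≥0} (h : ∀ u ≤ t, κ u = κ' u) (J : Finset ℝ≥0) :
    weightTerm κ J t = weightTerm κ' J t := by
  have h2 : ∏ s ∈ J with s < t, κ s = ∏ s ∈ J with s < t, κ' s :=
    Finset.prod_congr rfl fun s hs => h s (Finset.mem_filter.1 hs).2.le
  rw [weightTerm, weightTerm, leftWeight, leftWeight, expWeight_congr h, h2, h t le_rfl]

/-! ### The forward equation of the chain -/

section Chain

variable {Ω : Type*} {m : MeasurableSpace Ω} {N : ℕ} {A : ℝ≥0 → Matrix (Fin N) (Fin N) ℝ}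
  {X : ℝ≥0 → Ω → Fin N} {hX : ∀ t, Measurable (X t)} {Q : Measure Ω}

/-- The filtration generated by the chain. -/
abbrev chainFiltration (X : ℝ≥0 → Ω → Fin N) (hX : ∀ t, Measurable (X t)) : Filtration ℝ≥0 m :=
  Filtration.natural X fun r => (hX r).stronglyMeasurable

/-- The indicator of the event that the state `x` is `i`. -/
def stateInd (i x : Fin N) : ℝ := if x = i then 1 else 0

theorem measurable_stateInd (i : Fin N) : Measurable (stateInd i) := measurable_of_finite _

theorem abs_stateInd_le (i x : Fin N) : |stateInd i x| ≤ 1 := by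
  unfold stateInd; split_ifs <;> simp

theorem sum_mul_stateInd (f : Fin N → ℝ) (x : Fin N) : ∑ j, f j * stateInd j x = f x := by
  simp [stateInd]

theorem sum_stateInd (x : Fin N) : ∑ j, stateInd j x = 1 := by
  simpa using sum_mul_stateInd (fun _ => 1) x

theorem integrable_mul_stateInd {H : Ω → ℝ} (hH : Integrable H Q) {x : Ω → Fin N}
    (hx : Measurable x) (i : Fin N) : Integrable (fun ω => H ω * stateInd i (x ω)) Q :=
  hH.mul_bdd (c := 1) ((measurable_stateInd i).comp hx).aestronglyMeasurable
    (ae_of_all _ fun _ => abs_stateInd_le _ _)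

theorem IsRateMatrix.integrableOn (hA : IsRateMatrix A) (i j : Fin N) (s t : ℝ≥0) :
    IntegrableOn (fun u => A u i j) (Ioc s t) leb :=
  ((hA.locallyIntegrable i j).integrableOn_isCompact isCompact_Icc).mono_set Ioc_subset_Icc_self

variable [IsProbabilityMeasure Q]

/-- The forward equation for the expected occupation of the states, weighted by a variable `H`
from the past. -/
theorem IsMarkovChain.integral_mul_stateInd (h : IsMarkovChain A X hX Q) {s t : ℝ≥0} (hst : s ≤ t)
    {H : Ω → ℝ} (hHm : StronglyMeasurable[chainFiltration X hX s] H) (hH : Integrable H Q)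
    (i : Fin N) :
    ∫ ω, H ω * stateInd i (X t ω) ∂Q = ∫ ω, H ω * stateInd i (X s ω) ∂Q
      + ∫ u in Ioc s t, ∑ k, A u i k * ∫ ω, H ω * stateInd k (X u ω) ∂Q ∂leb := by
  obtain ⟨P, hP, hmark⟩ := h.markov
  have key : ∀ u, s ≤ u → ∀ k, ∫ ω, H ω * stateInd k (X u ω) ∂Q
      = ∑ j, P s u k j * ∫ ω, H ω * stateInd j (X s ω) ∂Q := by
    intro u hu k
    have hle := (chainFiltration X hX).le s
    have hind : (fun ω => stateInd k (X u ω)) = (X u ⁻¹' {k}).indicator fun _ => (1 : ℝ) := by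
      funext ω
      by_cases hk : X u ω = k <;> simp [stateInd, hk]
    have hI : Integrable (fun ω => stateInd k (X u ω)) Q := by
      rw [hind]
      exact (integrable_const 1).indicator (hX u (measurableSet_singleton k))
    have h1 := condExp_mul_of_stronglyMeasurable_left hHm (integrable_mul_stateInd hH (hX u) k) hI
    have h2 := hmark s u hu k
    rw [← hind] at h2
    calc ∫ ω, H ω * stateInd k (X u ω) ∂Q
        = ∫ ω, (Q[H * fun ω => stateInd k (X u ω) | chainFiltration X hX s]) ω ∂Q :=
          (integral_condExp hle).symm
      _ = ∫ ω, ∑ j, P s u k j * (H ω * stateInd j (X s ω)) ∂Q := by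
          refine integral_congr_ae ?_
          filter_upwards [h1, h2] with ω h1 h2
          rw [h1, Pi.mul_apply, h2, ← sum_mul_stateInd (P s u k) (X s ω), Finset.mul_sum]
          exact Finset.sum_congr rfl fun j _ => by ring
      _ = _ := by
          rw [integral_finsetSum _ fun j _ => (integrable_mul_stateInd hH (hX s) j).const_mul _]
          exact Finset.sum_congr rfl fun j _ => integral_const_mul _ _
  have hAP : ∀ j, IntegrableOn (fun u => (A u * P s u) i j) (Ioc s t) leb := by
    intro j
    simp only [Matrix.mul_apply]
    refine integrable_finsetSum _ fun k _ => ?_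
    have hc : ContinuousOn (fun u => P s u k j) (Icc s t) :=
      ((continuous_apply_apply k j).comp_continuousOn (hP.continuousOn s)).mono Icc_subset_Ici_self
    exact (((h.isRateMatrix.locallyIntegrable i k).integrableOn_isCompact
      isCompact_Icc).mul_continuousOn hc isCompact_Icc).mono_set Ioc_subset_Icc_self
  have h3 : ∫ u in Ioc s t, ∑ k, A u i k * ∫ ω, H ω * stateInd k (X u ω) ∂Q ∂leb
      = ∑ j, (∫ u in Ioc s t, (A u * P s u) i j ∂leb) * ∫ ω, H ω * stateInd j (X s ω) ∂Q := by
    have : ∀ j, (∫ u in Ioc s t, (A u * P s u) i j ∂leb) * ∫ ω, H ω * stateInd j (X s ω) ∂Q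
        = ∫ u in Ioc s t, (A u * P s u) i j * ∫ ω, H ω * stateInd j (X s ω) ∂Q ∂leb :=
      fun j => (integral_mul_const _ _).symm
    simp only [this]
    rw [← integral_finsetSum _ fun j _ => (hAP j).mul_const _]
    refine setIntegral_congr_fun measurableSet_Ioc fun u hu => ?_
    simp only [key u hu.1.le, Matrix.mul_apply, Finset.mul_sum, Finset.sum_mul]
    rw [Finset.sum_comm]
    exact Finset.sum_congr rfl fun j _ => Finset.sum_congr rfl fun k _ => by ring
  rw [h3, key t hst i]
  simp only [hP.forward s t hst, add_mul, Finset.sum_add_distrib]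
  congr 1
  simp [Matrix.one_apply]

/-- The chain does not jump at a fixed time: by the forward equation, `Q(X_s ≠ X_t)` is at most the
integral of the rates over `]s,t]`. -/
theorem IsMarkovChain.ae_leftLim_eq (h : IsMarkovChain A X hX Q) (t : ℝ≥0) :
    ∀ᵐ ω ∂Q, Function.leftLim (fun s => X s ω) t = X t ω := by
  rcases eq_zero_or_pos t with rfl | ht
  · exact ae_of_all _ fun ω => leftLim_zero _
  have := nhdsLT_neBot_of_pos ht
  set D : ℝ≥0 → Ω → ℝ := fun s ω => if X s ω = X t ω then 0 else 1 with hD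
  set f : ℝ≥0 → ℝ := fun u => ∑ j, ∑ k, |A u j k| with hf
  have hfint : IntegrableOn f (Ioc 0 t) leb :=
    integrable_finsetSum _ fun j _ => integrable_finsetSum _ fun k _ =>
      (h.isRateMatrix.integrableOn j k 0 t).abs
  have hDint : ∀ s, Measurable (D s) := fun s =>
    Measurable.ite (measurableSet_eq_fun (hX s) (hX t)) measurable_const measurable_const
  have hbound : ∀ s ≤ t, ∫ ω, D s ω ∂Q ≤ ∫ u in Ioc s t, f u ∂leb := by
    intro s hs
    have hb : ∀ j, Integrable (fun ω => stateInd j (X s ω)) Q := fun j => by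
      simpa using integrable_mul_stateInd (Q := Q) (integrable_const (1 : ℝ)) (hX s) j
    have hm : ∀ j, StronglyMeasurable[chainFiltration X hX s] fun ω => stateInd j (X s ω) :=
      fun j => ((measurable_stateInd j).comp ((Filtration.stronglyAdapted_natural
        (fun r => (hX r).stronglyMeasurable) s).measurable)).stronglyMeasurable
    -- the forward equation is applied with `H = 1_{X_s = j}` for every state `j`
    have hDs : ∀ ω, D s ω = ∑ j, (stateInd j (X s ω) * stateInd j (X s ω)
        - stateInd j (X s ω) * stateInd j (X t ω)) := by
      intro ω
      rw [Finset.sum_sub_distrib, sum_mul_stateInd (fun j => stateInd j (X s ω)),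
        sum_mul_stateInd (fun j => stateInd j (X s ω))]
      by_cases hst : X s ω = X t ω <;> simp [hD, stateInd, hst]
    have hi : ∀ j u, Integrable (fun ω => stateInd j (X s ω) * stateInd j (X u ω)) Q :=
      fun j u => integrable_mul_stateInd (hb j) (hX u) j
    simp only [hDs]
    rw [integral_finsetSum (f := fun j ω => stateInd j (X s ω) * stateInd j (X s ω)
      - stateInd j (X s ω) * stateInd j (X t ω)) _ fun j _ => (hi j s).sub (hi j t)]
    have hsub := hfint.mono_set (Ioc_subset_Ioc_left (zero_le (a := s)))
    have hsum : ∫ u in Ioc s t, f u ∂leb = ∑ j, ∫ u in Ioc s t, ∑ k, |A u j k| ∂leb := by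
      rw [← integral_finsetSum]
      exact fun j _ => integrable_finsetSum _ fun k _ =>
        (h.isRateMatrix.integrableOn j k s t).abs
    rw [hsum]
    refine Finset.sum_le_sum fun j _ => ?_
    rw [integral_sub (hi j s) (hi j t), h.integral_mul_stateInd hs (hm j) (hb j) j]
    rw [sub_add_cancel_left]
    refine (neg_le_abs _).trans ?_
    rw [← Real.norm_eq_abs]
    refine norm_integral_le_of_norm_le (integrable_finsetSum _ fun k _ =>
        (h.isRateMatrix.integrableOn j k s t).abs) (ae_of_all _ fun u => ?_)
    refine (norm_sum_le _ _).trans (Finset.sum_le_sum fun k _ => ?_)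
    rw [norm_mul, Real.norm_eq_abs (A u j k)]
    refine mul_le_of_le_one_right (abs_nonneg _) ?_
    refine (norm_integral_le_of_norm_le_const (C := 1) (ae_of_all _ fun ω => ?_)).trans
      (by simp)
    rw [norm_mul, ← one_mul (1 : ℝ)]
    exact mul_le_mul (abs_stateInd_le _ _) (abs_stateInd_le _ _) (norm_nonneg _) zero_le_one
  set D' : Ω → ℝ := fun ω => if Function.leftLim (fun s => X s ω) t = X t ω then 0 else 1 with hD'
  have hlim : ∀ ω, Tendsto (fun s => D s ω) (𝓝[<] t) (𝓝 (D' ω)) := fun ω =>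
    (continuous_of_discreteTopology (f := fun x : Fin N => if x = X t ω then (0 : ℝ) else 1)
      |>.tendsto _).comp ((h.cadlag ω).tendsto_leftLim t)
  have hlimint : Tendsto (fun s => ∫ ω, D s ω ∂Q) (𝓝[<] t) (𝓝 (∫ ω, D' ω ∂Q)) := by
    refine tendsto_integral_filter_of_dominated_convergence (fun _ => 1)
      (Eventually.of_forall fun s => (hDint s).aestronglyMeasurable)
      (Eventually.of_forall fun s => ae_of_all _ fun ω => ?_) (integrable_const 1)
      (ae_of_all _ hlim)
    simp only [hD]; split_ifs <;> simp
  have hzero : Tendsto (fun s => ∫ u in Ioc s t, f u ∂leb) (𝓝[<] t) (𝓝 0) := by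
    have h1 : Tendsto (fun s : ℝ≥0 => ENNReal.ofReal ((t : ℝ) - s)) (𝓝[<] t) (𝓝 0) := by
      have : Tendsto (fun s : ℝ≥0 => (t : ℝ) - s) (𝓝[<] t) (𝓝 ((t : ℝ) - t)) :=
        (NNReal.continuous_coe.tendsto t |>.mono_left nhdsWithin_le_nhds).const_sub _
      simpa using ENNReal.tendsto_ofReal this
    have h2 := Integrable.tendsto_setIntegral_nhds_zero (f := f) (μ := leb.restrict (Ioc 0 t))
      (s := fun s => Ioc s t) hfint (l := 𝓝[<] t) (by
        refine tendsto_of_tendsto_of_tendsto_of_le_of_le tendsto_const_nhds h1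
          (fun _ => zero_le) fun s => ?_
        exact (Measure.restrict_apply_le _ _).trans (leb_Ioc s t).le)
    refine h2.congr fun s => ?_
    rw [Measure.restrict_restrict measurableSet_Ioc,
      inter_eq_left.2 (Ioc_subset_Ioc_left zero_le)]
  have hle : ∫ ω, D' ω ∂Q ≤ 0 := le_of_tendsto_of_tendsto hlimint hzero
    (eventually_nhdsWithin_of_forall fun s hs => hbound s (mem_Iio.1 hs).le)
  have hD'm : AEStronglyMeasurable D' Q := by
    have hlm : Measurable fun ω => Function.leftLim (fun s => X s ω) t :=
      (measurable_leftLim_comp h.cadlag (φ := fun _ => t) measurable_const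
        fun _ s _ => hX s).comp (measurable_const.prodMk measurable_id : Measurable fun ω => (t, ω))
    exact (Measurable.ite (measurableSet_eq_fun hlm (hX t)) measurable_const
      measurable_const).aestronglyMeasurable
  have hD'0 : ∀ ω, 0 ≤ D' ω := fun ω => by simp only [hD']; split_ifs <;> simp
  have hD'int : Integrable D' Q := Integrable.of_bound hD'm 1 (ae_of_all _ fun ω => by
    simp only [hD']; split_ifs <;> simp)
  have hae := (integral_eq_zero_iff_of_nonneg hD'0 hD'int).1
    (le_antisymm hle (integral_nonneg hD'0))
  filter_upwards [hae] with ω hω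
  by_contra hne
  simp [hD', hne] at hω

end Chain

/-! ### The filter along a fixed observed path -/

section FixedPath

variable {Ω : Type*} {m : MeasurableSpace Ω} {N : ℕ} {A : ℝ≥0 → Matrix (Fin N) (Fin N) ℝ}
  {X : ℝ≥0 → Ω → Fin N} {hX : ∀ t, Measurable (X t)} {Q : Measure Ω}
  {c : Fin N → ℝ≥0 → ℝ} {J : Finset ℝ≥0} {T : ℝ≥0}

/-- The left-limit process `X_{t-}`. -/
def leftChain (X : ℝ≥0 → Ω → Fin N) (t : ℝ≥0) (ω : Ω) : Fin N :=
  Function.leftLim (fun s => X s ω) t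

/-- The path `u ↦ c (X_{u-}, u)` of the intensity, for a deterministic state-dependent
intensity `c`. -/
def chainIntensity (c : Fin N → ℝ≥0 → ℝ) (X : ℝ≥0 → Ω → Fin N) (ω : Ω) (u : ℝ≥0) : ℝ :=
  c (leftChain X u ω) u

/-- The unnormalized filter `E_Q[Z_t X_t]` along an observed path with jump times `J`, for which
the state-wise intensity is `c`. -/
def pathFilter (c : Fin N → ℝ≥0 → ℝ) (X : ℝ≥0 → Ω → Fin N) (J : Finset ℝ≥0) (Q : Measure Ω)
    (t : ℝ≥0) (i : Fin N) : ℝ :=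
  ∫ ω, weight (chainIntensity c X ω) J t * stateInd i (X t ω) ∂Q

/-- The left limit `E_Q[Z_{t-} X_{t-}]` of the unnormalized filter along an observed path. -/
def leftPathFilter (c : Fin N → ℝ≥0 → ℝ) (X : ℝ≥0 → Ω → Fin N) (J : Finset ℝ≥0) (Q : Measure Ω)
    (t : ℝ≥0) (i : Fin N) : ℝ :=
  ∫ ω, leftWeight (chainIntensity c X ω) J t * stateInd i (leftChain X t ω) ∂Q

theorem measurable_leftChain (hcad : ∀ ω, IsCadlagOn univ fun t => X t ω)
    (hX : ∀ t, Measurable (X t)) :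
    Measurable fun p : ℝ≥0 × Ω => leftChain X p.1 p.2 :=
  measurable_leftLim_comp hcad measurable_id fun _ s _ => hX s

theorem measurable_leftChain_right (hcad : ∀ ω, IsCadlagOn univ fun t => X t ω)
    (hX : ∀ t, Measurable (X t)) (t : ℝ≥0) : Measurable (leftChain X t) :=
  (measurable_leftChain hcad hX).comp (measurable_const.prodMk measurable_id)

theorem measurable_apply_chain (hc : ∀ i, Measurable (c i)) {L : ℝ≥0 × Ω → Fin N}
    (hL : Measurable L) : Measurable fun p : ℝ≥0 × Ω => c (L p) p.1 := by
  have h : Measurable fun q : Fin N × ℝ≥0 => c q.1 q.2 := measurable_from_prod_countable_right hc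
  exact h.comp (hL.prodMk measurable_fst)

theorem measurable_chainIntensity (hcad : ∀ ω, IsCadlagOn univ fun t => X t ω)
    (hX : ∀ t, Measurable (X t)) (hc : ∀ i, Measurable (c i)) :
    Measurable fun p : ℝ≥0 × Ω => chainIntensity c X p.2 p.1 :=
  measurable_apply_chain hc (measurable_leftChain hcad hX)

/-- The integrand `Z_{u-} (λ_u - 1)` depends on the chain only up to time `u`. -/
theorem stronglyMeasurable_weightTerm (hcad : ∀ ω, IsCadlagOn univ fun t => X t ω)
    (hX : ∀ t, Measurable (X t)) (hc : ∀ i, Measurable (c i)) (J : Finset ℝ≥0) (u : ℝ≥0) :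
    StronglyMeasurable[chainFiltration X hX u]
      fun ω => weightTerm (chainIntensity c X ω) J u := by
  have hadapt : ∀ v s, s ≤ min v u → Measurable[chainFiltration X hX u] (X s) := fun v s hs =>
    ((Filtration.stronglyAdapted_natural (fun r => (hX r).stronglyMeasurable) s).mono
      ((chainFiltration X hX).mono (hs.trans (min_le_right _ _)))).measurable
  have hL := @measurable_leftLim_comp Ω (Fin N) (chainFiltration X hX u) _ _ _ _ X hcad
    (fun v => min v u) (measurable_id.min measurable_const) hadapt
  have hκ := @measurable_apply_chain Ω (chainFiltration X hX u) N c hc _ hL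
  have hW := @measurable_weightTerm Ω (chainFiltration X hX u)
    (fun ω v => c (Function.leftLim (fun s => X s ω) (min v u)) v) hκ J
  have := hW.comp (@Measurable.prodMk Ω _ _ _ _ (chainFiltration X hX u) (fun _ => u) id
    (@measurable_const _ _ _ (chainFiltration X hX u) u)
    (@measurable_id _ (chainFiltration X hX u)))
  refine Measurable.stronglyMeasurable ?_
  convert! this using 1
  funext ω
  refine weightTerm_congr (fun v hv => ?_) J
  simp only [id, min_eq_left hv, chainIntensity, leftChain]

theorem chainIntensity_le (hcpos : ∀ i u, 0 < c i u) (ω : Ω) (u : ℝ≥0) :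
    chainIntensity c X ω u ≤ ∑ i, c i u :=
  Finset.single_le_sum (f := fun i => c i u) (fun i _ => (hcpos i u).le) (Finset.mem_univ _)

theorem chainIntensity_pos (hcpos : ∀ i u, 0 < c i u) (ω : Ω) (u : ℝ≥0) :
    0 < chainIntensity c X ω u := hcpos _ _

/-- A bound for the weight, uniform over the paths of the chain: it exists because the chain has
finitely many states. -/
def pathBound (c : Fin N → ℝ≥0 → ℝ) (J : Finset ℝ≥0) (T : ℝ≥0) : ℝ :=
  weightBound J (fun s => ∑ i, c i s) T

/-- On `{X_{u-} = i}` the factor `λ_u - 1` is the deterministic number `c i u - 1`. -/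
theorem integral_weightTerm_mul_leftChain (u : ℝ≥0) (i : Fin N) :
    ∫ ω, weightTerm (chainIntensity c X ω) J u * stateInd i (leftChain X u ω) ∂Q
      = (c i u - 1) * leftPathFilter c X J Q u i := by
  rw [leftPathFilter, ← integral_const_mul]
  refine integral_congr_ae (ae_of_all _ fun ω => ?_)
  by_cases hi : leftChain X u ω = i
  · simp only [weightTerm, chainIntensity, hi]; ring
  · simp [stateInd, hi]

theorem ae_abs_weight_mul_stateInd_le
    (hcpos : ∀ i u, 0 < c i u) (hint : ∀ᵐ ω ∂Q, IntegrableOn (chainIntensity c X ω) (Ioc 0 T) leb)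
    {t : ℝ≥0} (ht : t ≤ T) (x : Ω → Fin N) (i : Fin N) :
    ∀ᵐ ω ∂Q, ‖weight (chainIntensity c X ω) J t * stateInd i (x ω)‖ ≤ pathBound c J T := by
  filter_upwards [hint] with ω hω
  rw [norm_mul, Real.norm_of_nonneg (weight_nonneg (chainIntensity_pos hcpos ω) t)]
  exact (mul_le_of_le_one_right (weight_nonneg (chainIntensity_pos hcpos ω) t)
    (abs_stateInd_le _ _)).trans
    (weight_le (chainIntensity_pos hcpos ω) hω (fun s _ => chainIntensity_le hcpos ω s) ht)

theorem measurable_weight_mul_stateInd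
    (hcad : ∀ ω, IsCadlagOn univ fun t => X t ω) (hX : ∀ t, Measurable (X t))
    (hc : ∀ i, Measurable (c i))
    (t : ℝ≥0) (i : Fin N) :
    Measurable fun ω => weight (chainIntensity c X ω) J t * stateInd i (X t ω) :=
  ((measurable_weight (measurable_chainIntensity hcad hX hc) J).comp
    (measurable_const.prodMk measurable_id : Measurable fun ω => (t, ω))).mul
    ((measurable_stateInd i).comp (hX t))

variable [IsProbabilityMeasure Q]

theorem tendsto_pathFilter_right
    (hcad : ∀ ω, IsCadlagOn univ fun t => X t ω) (hX : ∀ t, Measurable (X t))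
    (hc : ∀ i, Measurable (c i)) (hcpos : ∀ i u, 0 < c i u)
    (hint : ∀ᵐ ω ∂Q, IntegrableOn (chainIntensity c X ω) (Ioc 0 T) leb)
    {t : ℝ≥0} (ht : t ∈ Icc 0 T) :
    Tendsto (pathFilter c X J Q) (𝓝[Icc 0 T ∩ Ici t] t) (𝓝 (pathFilter c X J Q t)) := by
  refine tendsto_pi_nhds.2 fun i => ?_
  refine tendsto_integral_filter_of_dominated_convergence (fun _ => pathBound c J T)
    (Eventually.of_forall fun s =>
      (measurable_weight_mul_stateInd hcad hX hc s i).aestronglyMeasurable)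
    (eventually_nhdsWithin_of_forall fun s hs =>
      ae_abs_weight_mul_stateInd_le hcpos hint hs.1.2 (X s) i) (integrable_const _) ?_
  filter_upwards [hint] with ω hω
  refine (tendsto_weight_right hω ht).mul ?_
  have h := (hcad ω t (mem_univ t)).1
  rw [univ_inter] at h
  exact ((continuous_of_discreteTopology (f := stateInd i)).tendsto _).comp
    (h.mono_left (nhdsWithin_mono _ inter_subset_right))

theorem tendsto_pathFilter_left
    (hcad : ∀ ω, IsCadlagOn univ fun t => X t ω) (hX : ∀ t, Measurable (X t))
    (hc : ∀ i, Measurable (c i)) (hcpos : ∀ i u, 0 < c i u)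
    (hint : ∀ᵐ ω ∂Q, IntegrableOn (chainIntensity c X ω) (Ioc 0 T) leb)
    {t : ℝ≥0} (ht : t ∈ Icc 0 T) :
    Tendsto (pathFilter c X J Q) (𝓝[Icc 0 T ∩ Iio t] t) (𝓝 (leftPathFilter c X J Q t)) := by
  refine tendsto_pi_nhds.2 fun i => ?_
  refine tendsto_integral_filter_of_dominated_convergence (fun _ => pathBound c J T)
    (Eventually.of_forall fun s =>
      (measurable_weight_mul_stateInd hcad hX hc s i).aestronglyMeasurable)
    (eventually_nhdsWithin_of_forall fun s hs =>
      ae_abs_weight_mul_stateInd_le hcpos hint hs.1.2 (X s) i) (integrable_const _) ?_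
  filter_upwards [hint] with ω hω
  refine (tendsto_weight_left hω ht).mul ?_
  exact ((continuous_of_discreteTopology (f := stateInd i)).tendsto _).comp
    (((hcad ω).tendsto_leftLim t).mono_left (nhdsWithin_mono _ inter_subset_right))

theorem integrable_weightTerm_prod
    (hcad : ∀ ω, IsCadlagOn univ fun t => X t ω) (hX : ∀ t, Measurable (X t))
    (hc : ∀ i, Measurable (c i)) (hcpos : ∀ i u, 0 < c i u)
    (hint : ∀ᵐ ω ∂Q, IntegrableOn (chainIntensity c X ω) (Ioc 0 T) leb)
    (hJ : ∀ s ∈ J, s ∈ Ioc 0 T) :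
    Integrable (fun p : ℝ≥0 × Ω => weightTerm (chainIntensity c X p.2) J p.1)
      ((drive J T).prod Q) := by
  have hm := measurable_weightTerm (measurable_chainIntensity hcad hX hc) J
  refine (integrable_prod_iff' hm.aestronglyMeasurable).2 ⟨?_, ?_⟩
  · filter_upwards [hint] with ω hω
    exact integrable_drive_iff.2 (integrableOn_weightTerm (chainIntensity_pos hcpos ω) hω
      fun s _ => chainIntensity_le hcpos ω s)
  · refine Integrable.of_bound (C := (∏ s ∈ J, max 1 (∑ i, c i s)) * (1 + 2 * (Real.exp T * T))
        + ∑ s ∈ J, weightBound J (fun s => ∑ i, c i s) T * ((∑ i, c i s) + 1))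
      (hm.norm.stronglyMeasurable.integral_prod_left').aestronglyMeasurable ?_
    filter_upwards [hint] with ω hω
    rw [Real.norm_of_nonneg (integral_nonneg fun _ => norm_nonneg _)]
    exact integral_abs_weightTerm_le (chainIntensity_pos hcpos ω) hω
      (fun s _ => chainIntensity_le hcpos ω s) hJ

/-- The forward equation in terms of the left-limit process, whose joint measurability makes
Fubini's theorem applicable. -/
theorem IsMarkovChain.integral_mul_leftChain (h : IsMarkovChain A X hX Q) {s t : ℝ≥0} (hst : s ≤ t)
    {H : Ω → ℝ} (hHm : StronglyMeasurable[chainFiltration X hX s] H) (hH : Integrable H Q)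
    (i : Fin N) :
    ∫ ω, H ω * stateInd i (leftChain X t ω) ∂Q = ∫ ω, H ω * stateInd i (leftChain X s ω) ∂Q
      + ∫ u in Ioc s t, ∑ k, A u i k * ∫ ω, H ω * stateInd k (leftChain X u ω) ∂Q ∂leb := by
  have key : ∀ u k, ∫ ω, H ω * stateInd k (leftChain X u ω) ∂Q
      = ∫ ω, H ω * stateInd k (X u ω) ∂Q := fun u k => integral_congr_ae <| by
    filter_upwards [h.ae_leftLim_eq u] with ω hω
    rw [leftChain, hω]
  simp only [key]
  exact h.integral_mul_stateInd hst hHm hH i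

theorem IsMarkovChain.pathFilter_eq (h : IsMarkovChain A X hX Q) (t : ℝ≥0) (i : Fin N) :
    pathFilter c X J Q t i
      = ∫ ω, weight (chainIntensity c X ω) J t * stateInd i (leftChain X t ω) ∂Q :=
  integral_congr_ae <| by
    filter_upwards [h.ae_leftLim_eq t] with ω hω
    rw [leftChain, hω]

theorem integrable_weightTerm_mul_leftChain
    (h : IsMarkovChain A X hX Q) (hc : ∀ i, Measurable (c i)) (hcpos : ∀ i u, 0 < c i u)
    (hint : ∀ᵐ ω ∂Q, IntegrableOn (chainIntensity c X ω) (Ioc 0 T) leb)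
    (hJ : ∀ s ∈ J, s ∈ Ioc 0 T)
    (r : ℝ≥0) (k : Fin N) :
    Integrable (fun p : ℝ≥0 × Ω =>
      weightTerm (chainIntensity c X p.2) J p.1 * stateInd k (leftChain X r p.2))
      ((drive J T).prod Q) :=
  (integrable_weightTerm_prod h.cadlag hX hc hcpos hint hJ).mul_bdd (c := 1)
    ((measurable_stateInd k).comp ((measurable_leftChain_right h.cadlag hX r).comp
      measurable_snd)).aestronglyMeasurable (ae_of_all _ fun _ => abs_stateInd_le _ _)

theorem integrable_weightTerm_mul_leftChain_diag
    (h : IsMarkovChain A X hX Q) (hc : ∀ i, Measurable (c i)) (hcpos : ∀ i u, 0 < c i u)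
    (hint : ∀ᵐ ω ∂Q, IntegrableOn (chainIntensity c X ω) (Ioc 0 T) leb)
    (hJ : ∀ s ∈ J, s ∈ Ioc 0 T)
    (k : Fin N) :
    Integrable (fun p : ℝ≥0 × Ω =>
      weightTerm (chainIntensity c X p.2) J p.1 * stateInd k (leftChain X p.1 p.2))
      ((drive J T).prod Q) :=
  (integrable_weightTerm_prod h.cadlag hX hc hcpos hint hJ).mul_bdd (c := 1)
    ((measurable_stateInd k).comp (measurable_leftChain h.cadlag hX)).aestronglyMeasurable
    (ae_of_all _ fun _ => abs_stateInd_le _ _)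

theorem integrableOn_jumpTerm_pathFilter
    (h : IsMarkovChain A X hX Q) (hc : ∀ i, Measurable (c i)) (hcpos : ∀ i u, 0 < c i u)
    (hint : ∀ᵐ ω ∂Q, IntegrableOn (chainIntensity c X ω) (Ioc 0 T) leb)
    (hJ : ∀ s ∈ J, s ∈ Ioc 0 T)
    (i : Fin N) :
    IntegrableOn (fun u => (c i u - 1) * leftPathFilter c X J Q u i) (Ioc 0 T) leb := by
  have h1 := (integrable_weightTerm_mul_leftChain_diag h hc hcpos hint hJ i).integral_prod_left
  simp only [integral_weightTerm_mul_leftChain] at h1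
  exact integrable_drive_iff.1 h1

theorem integrableOn_generatorTerm_pathFilter
    (h : IsMarkovChain A X hX Q) (hc : ∀ i, Measurable (c i)) (hcpos : ∀ i u, 0 < c i u)
    (hint : ∀ᵐ ω ∂Q, IntegrableOn (chainIntensity c X ω) (Ioc 0 T) leb)
    {t : ℝ≥0} (ht : t ≤ T) (i k : Fin N) :
    IntegrableOn (fun u => A u i k * pathFilter c X J Q u k) (Ioc 0 t) leb := by
  refine (h.isRateMatrix.integrableOn i k 0 t).mul_bdd (c := pathBound c J T) ?_ ?_
  · have hm : Measurable fun p : ℝ≥0 × Ω =>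
        weight (chainIntensity c X p.2) J p.1 * stateInd k (leftChain X p.1 p.2) :=
      (measurable_weight (measurable_chainIntensity h.cadlag hX hc) J).mul
        ((measurable_stateInd k).comp (measurable_leftChain h.cadlag hX))
    have := hm.stronglyMeasurable.integral_prod_right' (ν := Q)
    refine this.aestronglyMeasurable.congr (ae_of_all _ fun u => ?_)
    exact (h.pathFilter_eq u k).symm
  · filter_upwards [ae_restrict_mem measurableSet_Ioc] with u hu
    refine (norm_integral_le_of_norm_le_const
      (ae_abs_weight_mul_stateInd_le hcpos hint (hu.2.trans ht) (X u) k)).trans ?_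
    simp

/-- Integrating `Z_r = 1 + ∫ H (dy - du)` against the state of the chain at time `r`. -/
theorem pathFilter_eq_add_integral
    (h : IsMarkovChain A X hX Q) (hc : ∀ i, Measurable (c i)) (hcpos : ∀ i u, 0 < c i u)
    (hint : ∀ᵐ ω ∂Q, IntegrableOn (chainIntensity c X ω) (Ioc 0 T) leb)
    (hJ : ∀ s ∈ J, s ∈ Ioc 0 T)
    {r : ℝ≥0} (hr : r ≤ T) (i : Fin N) :
    pathFilter c X J Q r i = ∫ ω, stateInd i (leftChain X r ω) ∂Q
      + ∫ u in Ioc 0 r, driveSign J u * ∫ ω, weightTerm (chainIntensity c X ω) J u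
          * stateInd i (leftChain X r ω) ∂Q ∂drive J T := by
  have hI := integrable_weightTerm_mul_leftChain h hc hcpos hint hJ r i
  have hI' : Integrable (fun p : ℝ≥0 × Ω => driveSign J p.1 *
      (weightTerm (chainIntensity c X p.2) J p.1 * stateInd i (leftChain X r p.2)))
      (((drive J T).restrict (Ioc 0 r)).prod Q) := by
    have h1 : Integrable (fun p : ℝ≥0 × Ω =>
        weightTerm (chainIntensity c X p.2) J p.1 * stateInd i (leftChain X r p.2))
        (((drive J T).restrict (Ioc 0 r)).prod Q) :=
      hI.mono_measure (Measure.prod_mono Measure.restrict_le_self le_rfl)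
    exact h1.bdd_mul (c := 1)
      ((measurable_driveSign J).comp measurable_fst).aestronglyMeasurable
      (ae_of_all _ fun p => by simp [abs_driveSign])
  have hswap := integral_integral_swap (f := fun u ω => driveSign J u *
    (weightTerm (chainIntensity c X ω) J u * stateInd i (leftChain X r ω))) hI'
  simp only [integral_const_mul] at hswap
  rw [hswap, h.pathFilter_eq, ← integral_add]
  · refine integral_congr_ae ?_
    filter_upwards [hint] with ω hω
    rw [weight_eq_one_add_integral (chainIntensity_pos hcpos ω) hω hJ hr, add_mul, one_mul,
      ← integral_mul_const]
    simp only [mul_assoc]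
  · simpa using integrable_mul_stateInd (Q := Q) (integrable_const (1 : ℝ))
      (measurable_leftChain_right h.cadlag hX r) i
  · exact hI'.integral_prod_right

/-- The unnormalized filter along a fixed observed path solves the filter equation, in components
and with `dy - du` written as a density with respect to its total variation. -/
theorem pathFilter_equation
    (h : IsMarkovChain A X hX Q) (hc : ∀ i, Measurable (c i)) (hcpos : ∀ i u, 0 < c i u)
    (hint : ∀ᵐ ω ∂Q, IntegrableOn (chainIntensity c X ω) (Ioc 0 T) leb)
    (hJ : ∀ s ∈ J, s ∈ Ioc 0 T) {t : ℝ≥0} (ht : t ≤ T) (i : Fin N) :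
    pathFilter c X J Q t i = pathFilter c X J Q 0 i
      + ∫ u in Ioc 0 t, driveSign J u * ((c i u - 1) * leftPathFilter c X J Q u i) ∂drive J T
      + ∫ u in Ioc 0 t, ∑ k, A u i k * pathFilter c X J Q u k ∂leb := by
  -- `w u r k = E[H_u 1_{X_{r-} = k}]` and `v r k = Q(X_{r-} = k)`
  set w : ℝ≥0 → ℝ≥0 → Fin N → ℝ := fun u r k =>
    ∫ ω, weightTerm (chainIntensity c X ω) J u * stateInd k (leftChain X r ω) ∂Q with hw
  set v : ℝ≥0 → Fin N → ℝ := fun r k => ∫ ω, stateInd k (leftChain X r ω) ∂Q with hv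
  have hsplit : ∀ r ≤ T, ∀ k, pathFilter c X J Q r k
      = v r k + ∫ u in Ioc 0 r, driveSign J u * w u r k ∂drive J T :=
    fun r hr k => pathFilter_eq_add_integral h hc hcpos hint hJ hr k
  have hI := integrable_weightTerm_prod h.cadlag hX hc hcpos hint hJ
  have hA : ∀ k, IntegrableOn (fun u => A u i k) (Ioc 0 t) leb := fun k =>
    h.isRateMatrix.integrableOn i k 0 t
  have hwm : ∀ k, Measurable fun p : ℝ≥0 × ℝ≥0 => w p.1 p.2 k := fun k => by
    have hm : Measurable fun p : (ℝ≥0 × ℝ≥0) × Ω =>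
        weightTerm (chainIntensity c X p.2) J p.1.1 * stateInd k (leftChain X p.1.2 p.2) :=
      ((measurable_weightTerm (measurable_chainIntensity h.cadlag hX hc) J).comp
        ((measurable_fst.comp measurable_fst).prodMk measurable_snd)).mul
        ((measurable_stateInd k).comp ((measurable_leftChain h.cadlag hX).comp
          ((measurable_snd.comp measurable_fst).prodMk measurable_snd)))
    exact (hm.stronglyMeasurable.integral_prod_right' (ν := Q)).measurable
  have hHae : ∀ᵐ u ∂(drive J T).restrict (Ioc 0 t),
      Integrable (fun ω => weightTerm (chainIntensity c X ω) J u) Q :=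
    ae_restrict_of_ae hI.prod_right_ae
  set b : ℝ≥0 → ℝ := fun u => ∫ ω, ‖weightTerm (chainIntensity c X ω) J u‖ ∂Q with hb
  have hbint : Integrable b ((drive J T).restrict (Ioc 0 t)) :=
    (hI.norm.integral_prod_left).integrableOn
  -- the integrand of the double integral over `0 < u ≤ r ≤ t`
  set F : Fin N → ℝ≥0 → ℝ≥0 → ℝ := fun k u r =>
    A r i k * (Iic r).indicator (fun u => driveSign J u * w u r k) u with hF
  have hFint : ∀ k, Integrable (fun p : ℝ≥0 × ℝ≥0 => F k p.1 p.2)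
      (((drive J T).restrict (Ioc 0 t)).prod (leb.restrict (Ioc 0 t))) := by
    intro k
    have hdom := hbint.mul_prod (hA k)
    refine hdom.mono ((hA k).aestronglyMeasurable.comp_snd.mul ?_) ?_
    · have hs : MeasurableSet {p : ℝ≥0 × ℝ≥0 | p.1 ≤ p.2} :=
        measurableSet_le measurable_fst measurable_snd
      have hm : Measurable fun p : ℝ≥0 × ℝ≥0 => driveSign J p.1 * w p.1 p.2 k :=
        ((measurable_driveSign J).comp measurable_fst).mul (hwm k)
      exact (hm.indicator hs).aestronglyMeasurable
    · filter_upwards [Measure.quasiMeasurePreserving_fst.ae hHae] with p hp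
      have hwb : ‖w p.1 p.2 k‖ ≤ b p.1 :=
        norm_integral_le_of_norm_le hp.norm (ae_of_all _ fun ω => by
          rw [norm_mul]
          exact mul_le_of_le_one_right (norm_nonneg _) (abs_stateInd_le _ _))
      have hb0 : ‖b p.1‖ = b p.1 :=
        Real.norm_of_nonneg (integral_nonneg fun _ => norm_nonneg _)
      rw [norm_mul, norm_mul, mul_comm, hb0]
      refine mul_le_mul_of_nonneg_right ((norm_indicator_le_norm_self _ _).trans ?_)
        (norm_nonneg _)
      rw [norm_mul, Real.norm_eq_abs, abs_driveSign, one_mul]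
      exact hwb
  have hfwd : ∀ᵐ u ∂(drive J T).restrict (Ioc 0 t),
      driveSign J u * w u t i = driveSign J u * ((c i u - 1) * leftPathFilter c X J Q u i)
        + ∫ r in Ioc 0 t, ∑ k, F k u r ∂leb := by
    filter_upwards [hHae, ae_restrict_mem measurableSet_Ioc] with u hu hut
    have h1 := h.integral_mul_leftChain hut.2
      (stronglyMeasurable_weightTerm h.cadlag hX hc J u) hu i
    rw [integral_weightTerm_mul_leftChain] at h1
    have h2 : ∫ r in Ioc 0 t, ∑ k, F k u r ∂leb
        = driveSign J u * ∫ r in Ioc u t, ∑ k, A r i k * w u r k ∂leb := by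
      rw [← integral_Icc_eq_integral_Ioc (x := u) (y := t), ← integral_const_mul,
        ← inter_eq_right.2 (Icc_subset_Ioc hut.1 le_rfl : Icc u t ⊆ Ioc 0 t),
        ← setIntegral_indicator measurableSet_Icc]
      refine setIntegral_congr_fun measurableSet_Ioc fun r hr => ?_
      by_cases hur : u ≤ r
      · simp only [hF]
        rw [indicator_of_mem (mem_Icc.2 ⟨hur, hr.2⟩), Finset.mul_sum]
        refine Finset.sum_congr rfl fun k _ => ?_
        rw [indicator_of_mem (mem_Iic.2 hur)]
        ring
      · simp only [hF]
        rw [indicator_of_notMem fun h => hur h.1]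
        exact Finset.sum_eq_zero fun k _ => by
          rw [indicator_of_notMem (by simpa using hur), mul_zero]
    rw [h2, ← mul_add]
    exact congrArg _ h1
  have hjump : Integrable (fun u => driveSign J u * ((c i u - 1) * leftPathFilter c X J Q u i))
      ((drive J T).restrict (Ioc 0 t)) := by
    have h1 : Integrable (fun u => (c i u - 1) * leftPathFilter c X J Q u i) (drive J T) :=
      integrable_drive_iff.2 (integrableOn_jumpTerm_pathFilter h hc hcpos hint hJ i)
    exact (h1.bdd_mul (c := 1) (measurable_driveSign J).aestronglyMeasurable
      (ae_of_all _ fun p => by simp [abs_driveSign])).integrableOn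
  have hFsum := integrable_finsetSum Finset.univ fun k _ => hFint k
  have hswap : ∫ u in Ioc 0 t, ∫ r in Ioc 0 t, ∑ k, F k u r ∂leb ∂drive J T
      = ∫ r in Ioc 0 t, ∑ k, A r i k * (pathFilter c X J Q r k - v r k) ∂leb := by
    rw [integral_integral_swap hFsum]
    have hae : ∀ᵐ r ∂leb.restrict (Ioc 0 t), ∀ k,
        Integrable (fun u => F k u r) ((drive J T).restrict (Ioc 0 t)) :=
      ae_all_iff.2 fun k => (hFint k).prod_left_ae
    refine integral_congr_ae ?_
    filter_upwards [hae, ae_restrict_mem measurableSet_Ioc] with r hr hrt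
    rw [integral_finsetSum _ fun k _ => hr k]
    refine Finset.sum_congr rfl fun k _ => ?_
    rw [integral_const_mul, setIntegral_indicator measurableSet_Iic, Ioc_inter_Iic,
      min_eq_right hrt.2, hsplit r (hrt.2.trans ht) k, add_sub_cancel_left]
  have hv1 : v t i = v 0 i + ∫ r in Ioc 0 t, ∑ k, A r i k * v r k ∂leb := by
    have := h.integral_mul_leftChain (zero_le (a := t)) (H := fun _ => 1)
      stronglyMeasurable_const (integrable_const _) i
    simpa only [one_mul] using this
  have hv0 : v 0 i = pathFilter c X J Q 0 i := by
    rw [hsplit 0 zero_le i]; simp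
  have hAq : ∀ k, IntegrableOn (fun u => A u i k * pathFilter c X J Q u k) (Ioc 0 t) leb :=
    fun k => integrableOn_generatorTerm_pathFilter h hc hcpos hint ht i k
  have hAv : ∀ k, IntegrableOn (fun u => A u i k * v u k) (Ioc 0 t) leb := by
    intro k
    have hm : Measurable fun p : ℝ≥0 × Ω => stateInd k (leftChain X p.1 p.2) :=
      (measurable_stateInd k).comp (measurable_leftChain h.cadlag hX)
    refine (hA k).mul_bdd (c := 1)
      (hm.stronglyMeasurable.integral_prod_right' (ν := Q)).aestronglyMeasurable
      (ae_of_all _ fun r => ?_)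
    exact (norm_integral_le_of_norm_le_const (ae_of_all _ fun ω => abs_stateInd_le _ _)).trans
      (by simp)
  rw [hsplit t ht i, integral_congr_ae hfwd, integral_add hjump hFsum.integral_prod_left, hswap,
    hv1, hv0]
  have hsub : ∫ r in Ioc 0 t, ∑ k, A r i k * (pathFilter c X J Q r k - v r k) ∂leb
      = ∫ r in Ioc 0 t, ∑ k, A r i k * pathFilter c X J Q r k ∂leb
        - ∫ r in Ioc 0 t, ∑ k, A r i k * v r k ∂leb := by
    rw [← integral_sub (integrable_finsetSum _ fun k _ => hAq k)
      (integrable_finsetSum _ fun k _ => hAv k)]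
    simp only [mul_sub, Finset.sum_sub_distrib]
  rw [hsub]
  ring

end FixedPath

/-! ### Jump times of a counting path -/

/-- The time of the `(k+1)`-st jump of a counting path (junk if there is no such jump). -/
def jumpTime (y : CountingPath) (k : ℕ) : ℝ≥0 := sInf {u | y.1 0 + k < y.1 u}

/-- The jump times of a counting path in `]0,t]`. -/
def jumpFinset (y : CountingPath) (t : ℝ≥0) : Finset ℝ≥0 :=
  (Finset.range (y.1 t - y.1 0)).image (jumpTime y)

theorem exists_lt_eq_leftLim (y : CountingPath) {u : ℝ≥0} (hu : 0 < u) {v : ℝ≥0} (hv : v < u) :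
    ∃ w, v < w ∧ w < u ∧ y.1 w = Function.leftLim y.1 u := by
  have := nhdsLT_neBot_of_pos hu
  have h1 : ∀ᶠ w in 𝓝[<] u, y.1 w = Function.leftLim y.1 u :=
    y.2.monotone.tendsto_leftLim u (by simp : {Function.leftLim y.1 u} ∈ _)
  obtain ⟨w, hw, hwv, hwu⟩ := (h1.and (Ioo_mem_nhdsLT hv)).exists
  exact ⟨w, hwv, hwu, hw⟩

/-- Since the jumps are of size one, the `(k+1)`-st jump leads to the value `y 0 + k + 1`. -/
theorem jumpTime_spec (y : CountingPath) {t : ℝ≥0} {k : ℕ} (hk : k < y.1 t - y.1 0) :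
    0 < jumpTime y k ∧ jumpTime y k ≤ t ∧ y.1 (jumpTime y k) = y.1 0 + k + 1 ∧
      jump y.1 (jumpTime y k) = 1 := by
  set S : Set ℝ≥0 := {u | y.1 0 + k < y.1 u} with hS
  set u := jumpTime y k with hu
  have htS : t ∈ S := by simp only [hS, mem_ofPred_eq]; omega
  have hut : u ≤ t := csInf_le' htS
  have huS : y.1 0 + k < y.1 u := by
    obtain ⟨b, hb, hsub⟩ := (mem_nhdsGE_iff_exists_Ico_subset).1 (y.2.right_constant u)
    obtain ⟨s, hs, hsb⟩ := exists_lt_of_csInf_lt ⟨t, htS⟩ (mem_Ioi.1 hb)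
    have : y.1 s = y.1 u := hsub ⟨csInf_le' hs, hsb⟩
    rw [← this]; exact hs
  have hu0 : 0 < u := by
    rcases eq_zero_or_pos u with h | h
    · rw [h] at huS; omega
    · exact h
  have hleft : Function.leftLim y.1 u ≤ y.1 0 + k := by
    obtain ⟨w, -, hw, hwe⟩ := exists_lt_eq_leftLim y hu0 hu0
    rw [← hwe]
    exact not_lt.1 fun h => (notMem_of_lt_csInf' hw) h
  have hj := y.2.jump_le_one u
  simp only [jump] at hj ⊢
  exact ⟨hu0, hut, by omega, by omega⟩

theorem jumpTime_injOn (y : CountingPath) (t : ℝ≥0) :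
    InjOn (jumpTime y) (Finset.range (y.1 t - y.1 0)) := by
  intro k hk l hl h
  have h1 := (jumpTime_spec y (Finset.mem_range.1 hk)).2.2.1
  have h2 := (jumpTime_spec y (Finset.mem_range.1 hl)).2.2.1
  rw [h] at h1
  omega

theorem mem_jumpFinset {y : CountingPath} {t u : ℝ≥0} :
    u ∈ jumpFinset y t ↔ u ∈ Ioc 0 t ∧ jump y.1 u ≠ 0 := by
  simp only [jumpFinset, Finset.mem_image, Finset.mem_range]
  constructor
  · rintro ⟨k, hk, rfl⟩
    obtain ⟨h1, h2, -, h4⟩ := jumpTime_spec y hk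
    exact ⟨⟨h1, h2⟩, by omega⟩
  · rintro ⟨⟨hu0, hut⟩, hj⟩
    simp only [jump] at hj
    have h0 : y.1 0 ≤ Function.leftLim y.1 u := y.2.monotone.le_leftLim hu0
    have ht : y.1 u ≤ y.1 t := y.2.monotone hut
    refine ⟨Function.leftLim y.1 u - y.1 0, by omega, ?_⟩
    have hset : {w | y.1 0 + (Function.leftLim y.1 u - y.1 0) < y.1 w} = Ici u := by
      ext w
      rw [mem_ofPred_eq, mem_Ici]
      constructor
      · intro hw
        by_contra! hwu
        have := y.2.monotone.le_leftLim hwu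
        omega
      · intro hw
        have := y.2.monotone hw
        omega
    rw [jumpTime, hset, csInf_Ici]

theorem jump_eq_one {y : CountingPath} {t u : ℝ≥0} (hu : u ∈ jumpFinset y t) :
    jump y.1 u = 1 := by
  have := y.2.jump_le_one u
  have := (mem_jumpFinset.1 hu).2
  omega

theorem jumpFinset_filter_le (y : CountingPath) {t T : ℝ≥0} (ht : t ≤ T) :
    {s ∈ jumpFinset y T | s ≤ t} = jumpFinset y t := by
  ext u
  simp only [Finset.mem_filter, mem_jumpFinset, mem_Ioc]
  exact ⟨fun h => ⟨⟨h.1.1.1, h.2⟩, h.1.2⟩, fun h => ⟨⟨⟨h.1.1, h.1.2.trans ht⟩, h.2⟩, h.1.2⟩⟩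

theorem jumpIntegral_eq_sum {E : Type*} [AddCommGroup E] [Module ℝ E] (y : CountingPath)
    {t T : ℝ≥0} (ht : t ≤ T) (h : ℝ≥0 → E) :
    jumpIntegral y t h = ∑ s ∈ jumpFinset y T with s ≤ t, h s := by
  rw [jumpFinset_filter_le y ht, jumpIntegral,
    finsum_mem_eq_sum_of_inter_support_eq (t := jumpFinset y t)]
  · exact Finset.sum_congr rfl fun s hs => by rw [jump_eq_one hs]; simp
  · ext u
    simp only [mem_inter_iff, Finset.mem_coe, mem_jumpFinset, Function.mem_support]
    refine ⟨fun h => ⟨⟨h.1, fun h0 => h.2 (by simp [h0])⟩, h.2⟩, fun h => ⟨h.1.1, h.2⟩⟩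

theorem weight_jumpFinset {y : CountingPath} {t T : ℝ≥0} (ht : t ≤ T) (κ : ℝ≥0 → ℝ) :
    weight κ (jumpFinset y T) t = weight κ (jumpFinset y t) t := by
  rw [weight, weight, jumpFinset_filter_le y ht, jumpFinset_filter_le y le_rfl]

section ObservedPath

variable {Ω : Type*} {m : MeasurableSpace Ω} {N : ℕ}

/-- The state-wise intensities along an observed path. -/
def pathIntensity (lam : Fin N → ℝ≥0 → CountingPath → ℝ) (y : CountingPath) (i : Fin N)
    (u : ℝ≥0) : ℝ := lam i u y

theorem density_eq_weight (lam : Fin N → ℝ≥0 → CountingPath → ℝ) (X : ℝ≥0 → Ω → Fin N)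
    (Y : Ω → CountingPath) (t : ℝ≥0) (ω : Ω) :
    density lam X Y t ω
      = weight (chainIntensity (pathIntensity lam (Y ω)) X ω) (jumpFinset (Y ω) t) t := by
  rw [weight, jumpFinset_filter_le _ le_rfl, density]
  congr 1
  rw [finprod_mem_eq_prod_of_inter_mulSupport_eq (t := jumpFinset (Y ω) t)]
  · refine Finset.prod_congr rfl fun s hs => ?_
    rw [jump_eq_one hs, pow_one]; rfl
  · ext u
    simp only [mem_inter_iff, Finset.mem_coe, mem_jumpFinset, Function.mem_mulSupport]
    refine ⟨fun h => ⟨⟨h.1, fun h0 => h.2 (by simp [h0])⟩, h.2⟩, fun h => ⟨h.1.1, h.2⟩⟩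

theorem density_pos {lam : Fin N → ℝ≥0 → CountingPath → ℝ} (hlam : IsIntensity lam)
    (X : ℝ≥0 → Ω → Fin N) (Y : Ω → CountingPath) (t : ℝ≥0) (ω : Ω) :
    0 < density lam X Y t ω := by
  rw [density_eq_weight]
  exact mul_pos (expWeight_pos _ _) (prod_filter_pos (fun _ => hlam.pos _ _ _) _)

/-! ### Measurability of the density in the chain and the observed path -/

/-- A jump time, cut off to be `0` after time `t`, is known at time `t`. -/
theorem measurable_jumpTime {S : Type*} [MeasurableSpace S] {y : S → CountingPath} {t : ℝ≥0}
    (hy : ∀ s ≤ t, Measurable fun σ => (y σ).1 s) (k : ℕ) :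
    Measurable fun σ => if k < (y σ).1 t - (y σ).1 0 then jumpTime (y σ) k else 0 := by
  have hD : Measurable fun σ => (y σ).1 t - (y σ).1 0 := (hy t le_rfl).sub (hy 0 zero_le)
  refine measurable_of_Iic fun u => ?_
  have h1 : MeasurableSet {σ | (y σ).1 t - (y σ).1 0 ≤ k} := measurableSet_le hD measurable_const
  have h2 : MeasurableSet {σ | (y σ).1 0 + k < (y σ).1 (min u t)} :=
    measurableSet_lt ((hy 0 zero_le).add_const k) (hy _ (min_le_right _ _))
  convert! h1.union h2 using 1
  ext σ
  simp only [mem_preimage, mem_Iic, mem_union, mem_ofPred_eq]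
  by_cases hk : k < (y σ).1 t - (y σ).1 0
  · obtain ⟨-, hle, hval, -⟩ := jumpTime_spec (y σ) hk
    rw [if_pos hk]
    constructor
    · intro h
      right
      have := (y σ).2.monotone (le_min h hle)
      omega
    · rintro (h | h)
      · omega
      · exact (csInf_le' h : jumpTime (y σ) k ≤ min u t).trans (min_le_left _ _)
  · rw [if_neg hk]
    exact ⟨fun _ => Or.inl (not_lt.1 hk), fun _ => zero_le⟩

theorem weight_congr {κ κ' : ℝ≥0 → ℝ} {t : ℝ≥0} (h : ∀ u ≤ t, κ u = κ' u) (J : Finset ℝ≥0) :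
    weight κ J t = weight κ' J t := by
  have h2 : ∏ s ∈ J with s ≤ t, κ s = ∏ s ∈ J with s ≤ t, κ' s :=
    Finset.prod_congr rfl fun s hs => h s (Finset.mem_filter.1 hs).2
  rw [weight, weight, expWeight_congr h, h2]

/-- Measurability of the weight when both the intensity and the jump times depend on a
parameter `σ`. -/
theorem measurable_weight_jumpFinset {S : Type*} [MeasurableSpace S] {y : S → CountingPath}
    {t : ℝ≥0} (hy : ∀ s ≤ t, Measurable fun σ => (y σ).1 s) {κ : S → ℝ≥0 → ℝ}
    (hκ : Measurable fun p : ℝ≥0 × S => κ p.2 p.1) :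
    Measurable fun σ => weight (κ σ) (jumpFinset (y σ) t) t := by
  have hD : Measurable fun σ => (y σ).1 t - (y σ).1 0 := (hy t le_rfl).sub (hy 0 zero_le)
  refine ((measurable_expWeight hκ).comp
    (measurable_const.prodMk measurable_id : Measurable fun σ => (t, σ))).mul ?_
  set τ : ℕ → S → ℝ≥0 := fun k σ =>
    if k < (y σ).1 t - (y σ).1 0 then jumpTime (y σ) k else 0 with hτ
  have hprod : Measurable fun q : ℕ × S => ∏ k ∈ Finset.range q.1, κ q.2 (τ k q.2) :=
    measurable_from_prod_countable_right fun n => by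
      exact Finset.measurable_fun_prod (Finset.range n) fun k _ =>
        hκ.comp ((measurable_jumpTime hy k).prodMk measurable_id)
  convert! hprod.comp (hD.prodMk measurable_id) using 1
  funext σ
  rw [jumpFinset_filter_le _ le_rfl, jumpFinset, Finset.prod_image (jumpTime_injOn _ _)]
  refine Finset.prod_congr rfl fun k hk => ?_
  simp only [hτ, id, if_pos (Finset.mem_range.1 hk)]

theorem predictable_le_prod {Ω : Type*} {m : MeasurableSpace Ω} (𝓕 : Filtration ℝ≥0 m) :
    𝓕.predictable ≤ (inferInstance : MeasurableSpace (ℝ≥0 × Ω)) :=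
  measurableSpace_le_predictable_of_measurableSet
    (fun _ hA => (measurableSet_singleton _).prod (𝓕.le _ _ hA))
    fun _ _ hA => measurableSet_Ioi.prod (𝓕.le _ _ hA)

theorem IsIntensity.measurable {lam : Fin N → ℝ≥0 → CountingPath → ℝ} (hlam : IsIntensity lam)
    (i : Fin N) : Measurable fun p : ℝ≥0 × CountingPath => lam i p.1 p.2 :=
  ((hlam.predictable i).mono (predictable_le_prod _)).measurable

theorem IsIntensity.measurable_pathIntensity {lam : Fin N → ℝ≥0 → CountingPath → ℝ}
    (hlam : IsIntensity lam) (y : CountingPath) (i : Fin N) :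
    Measurable (pathIntensity lam y i) :=
  (hlam.measurable i).comp (measurable_id.prodMk measurable_const)

theorem measurable_eval_pathFiltration {s t : ℝ≥0} (hst : s ≤ t) :
    Measurable[pathFiltration t] fun y : CountingPath => y.1 s :=
  ((Filtration.stronglyAdapted_natural
    (fun r => (measurable_eval r).stronglyMeasurable) s).mono (pathFiltration.mono hst)).measurable

/-- The density is jointly measurable in the chain and the observed path up to time `t`. -/
theorem measurable_decoupled_weight {X : ℝ≥0 → Ω → Fin N}
    (hcad : ∀ ω, IsCadlagOn univ fun t => X t ω) (hX : ∀ t, Measurable (X t))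
    {lam : Fin N → ℝ≥0 → CountingPath → ℝ} (hlam : IsIntensity lam) (t : ℝ≥0) :
    Measurable[m.prod (pathFiltration t)] fun p : Ω × CountingPath =>
      weight (chainIntensity (pathIntensity lam p.2) X p.1) (jumpFinset p.2 t) t := by
  let _ : MeasurableSpace CountingPath := pathFiltration t
  -- up to time `t` the intensity at `u` is the intensity at `min u t`, to which progressive
  -- measurability applies
  have hprog : ∀ i, Measurable fun q : ℝ≥0 × CountingPath => lam i (min q.1 t) q.2 := by
    intro i
    have h1 := ((hlam.predictable i).isStronglyProgressive t).measurable
    have h2 : Measurable fun q : ℝ≥0 × CountingPath =>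
        ((⟨min q.1 t, mem_Iic.2 (min_le_right _ _)⟩ : Iic t), q.2) :=
      ((measurable_fst.min measurable_const).subtype_mk).prodMk measurable_snd
    exact h1.comp h2
  have hL : Measurable fun q : ℝ≥0 × Ω × CountingPath => leftChain X q.1 q.2.1 :=
    (measurable_leftChain hcad hX).comp
      (measurable_fst.prodMk (measurable_fst.comp measurable_snd))
  have hall : Measurable fun q : Fin N × ℝ≥0 × CountingPath =>
      lam q.1 (min q.2.1 t) q.2.2 := measurable_from_prod_countable_right hprog
  have hκ : Measurable fun q : ℝ≥0 × Ω × CountingPath =>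
      lam (leftChain X q.1 q.2.1) (min q.1 t) q.2.2 :=
    hall.comp (hL.prodMk (measurable_fst.prodMk (measurable_snd.comp measurable_snd)))
  have := measurable_weight_jumpFinset (S := Ω × CountingPath) (y := Prod.snd) (t := t)
    (fun s hs => (measurable_eval_pathFiltration hs).comp measurable_snd)
    (κ := fun p u => lam (leftChain X u p.1) (min u t) p.2) hκ
  convert! this using 1
  funext p
  refine weight_congr (fun u hu => ?_) _
  simp only [min_eq_left hu, chainIntensity, pathIntensity]

/-- The set of chain paths and observed paths with integrable intensity is measurable. -/
theorem measurableSet_integrableOn_intensity {X : ℝ≥0 → Ω → Fin N}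
    (hcad : ∀ ω, IsCadlagOn univ fun t => X t ω) (hX : ∀ t, Measurable (X t))
    {lam : Fin N → ℝ≥0 → CountingPath → ℝ} (hlam : IsIntensity lam) (T : ℝ≥0) :
    MeasurableSet {p : Ω × CountingPath |
      IntegrableOn (chainIntensity (pathIntensity lam p.2) X p.1) (Ioc 0 T) leb} := by
  have hall : Measurable fun q : Fin N × ℝ≥0 × CountingPath => lam q.1 q.2.1 q.2.2 :=
    measurable_from_prod_countable_right hlam.measurable
  have hκ : Measurable fun q : (Ω × CountingPath) × ℝ≥0 =>
      chainIntensity (pathIntensity lam q.1.2) X q.1.1 q.2 :=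
    hall.comp (((measurable_leftChain hcad hX).comp
      (measurable_snd.prodMk (measurable_fst.comp measurable_fst))).prodMk
      (measurable_snd.prodMk (measurable_snd.comp measurable_fst)))
  exact _root_.measurableSet_integrable (μ := leb.restrict (Ioc 0 T)) hκ.stronglyMeasurable

end ObservedPath

/-! ### Conditioning on one of two independent variables -/

section Decoupling

variable {Ω S R E : Type*} {𝒢 : MeasurableSpace R} {m : MeasurableSpace Ω}
  {mS : MeasurableSpace S} {mR : MeasurableSpace R} {Q : Measure Ω} [IsProbabilityMeasure Q]
  {W : Ω → S} {Y : Ω → R}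

/-- What holds almost surely for a pair of independent variables holds almost surely for the first
one, for almost every fixed value of the second one. -/
theorem ae_decoupled (hW : Measurable W) (hY : Measurable Y) (hWY : IndepFun W Y Q)
    {p : S → R → Prop} (hp : MeasurableSet {z : S × R | p z.1 z.2})
    (h : ∀ᵐ ω ∂Q, p (W ω) (Y ω)) : ∀ᵐ y ∂Q.map Y, ∀ᵐ ω ∂Q, p (W ω) y := by
  have h1 : ∀ᵐ z ∂Q.map (fun ω => (W ω, Y ω)), p z.1 z.2 :=
    (ae_map_iff (hW.prodMk hY).aemeasurable hp).2 h
  rw [(indepFun_iff_map_prod_eq_prod_map_map hW.aemeasurable hY.aemeasurable).1 hWY] at h1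
  have := Measure.isProbabilityMeasure_map (μ := Q) hW.aemeasurable
  have := Measure.isProbabilityMeasure_map (μ := Q) hY.aemeasurable
  filter_upwards [(Measure.ae_ae_comm hp).1 (Measure.ae_ae_of_ae_prod h1)] with y hy
  exact ae_of_ae_map hW.aemeasurable hy

/-- For independent `W` and `Y`, the conditional expectation of `F (W, Y)` given `Y` is computed by
integrating over `W` alone. The σ-algebra `𝒢` restricts the information on `Y`, and then `F` must
depend on `Y` through `𝒢` only. -/
theorem condExp_decoupled [NormedAddCommGroup E] [NormedSpace ℝ E] [CompleteSpace E]
    (hW : Measurable W) (hY : Measurable Y) (hWY : IndepFun W Y Q)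
    (h𝒢 : 𝒢 ≤ mR) {F : S × R → E}
    (hF : StronglyMeasurable[mS.prod 𝒢] F) (hint : Integrable (fun ω => F (W ω, Y ω)) Q) :
    (fun ω => ∫ ω', F (W ω', Y ω) ∂Q)
      =ᵐ[Q] Q[fun ω => F (W ω, Y ω) | MeasurableSpace.comap Y 𝒢] := by
  have hle : mS.prod 𝒢 ≤ mS.prod mR := sup_le_sup le_rfl (MeasurableSpace.comap_mono h𝒢)
  have hF' : StronglyMeasurable F := hF.mono hle
  have hWp := Measure.isProbabilityMeasure_map (μ := Q) hW.aemeasurable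
  have hYp := Measure.isProbabilityMeasure_map (μ := Q) hY.aemeasurable
  have hlaw := (indepFun_iff_map_prod_eq_prod_map_map hW.aemeasurable hY.aemeasurable).1 hWY
  set G : R → E := fun y => ∫ s, F (s, y) ∂Q.map W with hG
  have hGm : StronglyMeasurable[𝒢] G :=
    @StronglyMeasurable.integral_prod_left' _ _ _ _ 𝒢 _ _ _ _ F hF
  have hGeq : ∀ y, ∫ ω', F (W ω', y) ∂Q = G y := fun y =>
    (integral_map hW.aemeasurable
      (hF'.comp_measurable measurable_prodMk_right).aestronglyMeasurable).symm
  simp only [hGeq]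
  have hFint : Integrable F ((Q.map W).prod (Q.map Y)) := by
    rw [← hlaw]
    exact (integrable_map_measure hF'.aestronglyMeasurable (hW.prodMk hY).aemeasurable).2 hint
  have hGint : Integrable G (Q.map Y) := hFint.integral_prod_right
  refine ae_eq_condExp_of_forall_setIntegral_eq
    ((MeasurableSpace.comap_mono h𝒢).trans hY.comap_le) hint
    (fun s _ _ => (hGint.comp_measurable hY).integrableOn) ?_
    (hGm.comp_measurable (@comap_measurable _ _ 𝒢 Y)).aestronglyMeasurable
  rintro _ ⟨D, hD, rfl⟩ -
  have hD' : MeasurableSet D := h𝒢 _ hD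
  have h1 : ∫ ω in Y ⁻¹' D, G (Y ω) ∂Q = ∫ y in D, G y ∂Q.map Y :=
    (setIntegral_map hD' (hGm.mono h𝒢).aestronglyMeasurable hY.aemeasurable).symm
  have h2 : ∫ ω in Y ⁻¹' D, F (W ω, Y ω) ∂Q
      = ∫ z in univ ×ˢ D, F z ∂(Q.map W).prod (Q.map Y) := by
    rw [← hlaw, setIntegral_map (MeasurableSet.univ.prod hD') hF'.aestronglyMeasurable
      (hW.prodMk hY).aemeasurable]
    congr 2
    ext ω
    simp
  rw [h1, h2, ← Measure.prod_restrict, Measure.restrict_univ, integral_prod_symm]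
  rw [← Measure.restrict_univ (μ := Q.map W), Measure.prod_restrict]
  exact hFint.integrableOn

end Decoupling

/-! ### Bayes' formula -/

section Bayes

variable {Ω : Type*} {𝒢 𝓕 m : MeasurableSpace Ω} {N : ℕ} {P Q : Measure Ω}
  {Z : Ω → ℝ} {x : Ω → Fin N} {q : Ω → Fin N → ℝ}

theorem basisVec_apply (i j : Fin N) : basisVec j i = stateInd i j := by
  simp only [basisVec, stateInd, Pi.single_apply, eq_comm]

/-- The density is only given on `𝓕`, so the two measures are compared after restriction to `𝓕`. -/
theorem integral_eq_of_density (h𝓕 : 𝓕 ≤ m) (hZm : StronglyMeasurable[𝓕] Z) (hZpos : ∀ ω, 0 < Z ω)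
    (hP : ∀ B, MeasurableSet[𝓕] B → P B = ∫⁻ ω in B, ENNReal.ofReal (Z ω) ∂Q)
    {f : Ω → ℝ} (hf : StronglyMeasurable[𝓕] f) : ∫ ω, f ω ∂P = ∫ ω, Z ω * f ω ∂Q := by
  have hZ' : Measurable fun ω => ENNReal.ofReal (Z ω) :=
    (hZm.measurable.mono h𝓕 le_rfl).ennreal_ofReal
  have htrim : P.trim h𝓕 = (Q.withDensity fun ω => ENNReal.ofReal (Z ω)).trim h𝓕 := by
    refine @Measure.ext _ 𝓕 _ _ fun B hB => ?_
    rw [trim_measurableSet_eq h𝓕 hB, trim_measurableSet_eq h𝓕 hB, hP B hB,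
      withDensity_apply _ (h𝓕 _ hB)]
  rw [integral_trim h𝓕 hf, htrim, ← integral_trim h𝓕 hf,
    integral_withDensity_eq_integral_toReal_smul hZ' (ae_of_all _ fun _ => ENNReal.ofReal_lt_top)]
  simp only [ENNReal.toReal_ofReal (hZpos _).le, smul_eq_mul]

theorem stronglyMeasurable_of_eval {S : Type*} {mS : MeasurableSpace S} {f : S → Fin N → ℝ}
    (hf : ∀ i, StronglyMeasurable fun σ => f σ i) : StronglyMeasurable f :=
  (measurable_pi_lambda f fun i => (hf i).measurable).stronglyMeasurable

/-- The Kallianpur–Striebel formula: conditional expectations under a measure with density `Z`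
are obtained by normalizing the conditional expectation of `Z` times the variable. -/
theorem bayes_formula [IsProbabilityMeasure P] [IsProbabilityMeasure Q] (h𝒢𝓕 : 𝒢 ≤ 𝓕) (h𝓕 : 𝓕 ≤ m)
    (hZm : StronglyMeasurable[𝓕] Z) (hZpos : ∀ ω, 0 < Z ω) (hZint : Integrable Z Q)
    (hP : ∀ B, MeasurableSet[𝓕] B → P B = ∫⁻ ω in B, ENNReal.ofReal (Z ω) ∂Q)
    (hx : Measurable[𝓕] x) (hq : StronglyMeasurable[𝒢] q)
    (hqcond : q =ᵐ[Q] Q[fun ω => Z ω • basisVec (x ω) | 𝒢]) :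
    ∀ᵐ ω ∂P, 0 < q ω ⬝ᵥ 1 ∧ P[fun ω' => basisVec (x ω') | 𝒢] ω = (q ω ⬝ᵥ 1)⁻¹ • q ω := by
  have h𝒢 : 𝒢 ≤ m := h𝒢𝓕.trans h𝓕
  have hxm : Measurable x := hx.mono h𝓕 le_rfl
  have hind : ∀ i, Integrable (fun ω => Z ω * stateInd i (x ω)) Q := fun i =>
    integrable_mul_stateInd hZint hxm i
  have hvec : Integrable (fun ω => Z ω • basisVec (x ω)) Q :=
    Integrable.of_eval fun i => by simpa [basisVec_apply] using hind i
  have hqint : Integrable q Q := (integrable_congr hqcond).2 integrable_condExp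
  have hqi : ∀ i, StronglyMeasurable[𝒢] fun ω => q ω i := fun i =>
    (continuous_apply i).comp_stronglyMeasurable hq
  have hqset : ∀ B, MeasurableSet[𝒢] B → ∀ i,
      ∫ ω in B, q ω i ∂Q = ∫ ω in B, Z ω * stateInd i (x ω) ∂Q := by
    intro B hB i
    have h1 : ∫ ω in B, q ω ∂Q = ∫ ω in B, Z ω • basisVec (x ω) ∂Q := by
      rw [← setIntegral_condExp h𝒢 hvec hB]
      exact integral_congr_ae (ae_restrict_of_ae hqcond)
    have h2 := congrFun h1 i
    rw [eval_integral fun j => (hqint.eval j).integrableOn,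
      eval_integral fun j => (hvec.eval j).integrableOn] at h2
    simpa [basisVec_apply] using h2
  have hsm : StronglyMeasurable[𝒢] fun ω => q ω ⬝ᵥ 1 := by
    simp only [dotProduct, Pi.one_apply, mul_one]
    exact Finset.stronglyMeasurable_fun_sum _ fun i _ => hqi i
  have hsint : Integrable (fun ω => q ω ⬝ᵥ 1) Q := by
    simp only [dotProduct, Pi.one_apply, mul_one]
    exact integrable_finsetSum _ fun i _ => hqint.eval i
  have hsset : ∀ B, MeasurableSet[𝒢] B → ∫ ω in B, q ω ⬝ᵥ 1 ∂Q = ∫ ω in B, Z ω ∂Q := by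
    intro B hB
    simp only [dotProduct, Pi.one_apply, mul_one]
    rw [integral_finsetSum _ fun i _ => (hqint.eval i).integrableOn,
      Finset.sum_congr rfl fun i _ => hqset B hB i,
      ← integral_finsetSum _ fun i _ => (hind i).integrableOn]
    simp only [← Finset.mul_sum, sum_stateInd, mul_one]
  have hscond : (fun ω => q ω ⬝ᵥ 1) =ᵐ[Q] Q[Z | 𝒢] :=
    ae_eq_condExp_of_forall_setIntegral_eq h𝒢 hZint (fun B _ _ => hsint.integrableOn)
      (fun B hB _ => hsset B hB) hsm.aestronglyMeasurable
  -- positivity, under `Q`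
  have hspos : ∀ᵐ ω ∂Q, 0 < q ω ⬝ᵥ 1 := by
    have hB : MeasurableSet[𝒢] {ω | q ω ⬝ᵥ 1 ≤ 0} :=
      hsm.measurable measurableSet_Iic
    have h1 : ∫ ω in {ω | q ω ⬝ᵥ 1 ≤ 0}, Z ω ∂Q ≤ 0 := by
      rw [← hsset _ hB]
      exact setIntegral_nonpos (h𝒢 _ hB) fun ω hω => hω
    have h2 := (setIntegral_pos_iff_support_of_nonneg_ae (s := {ω | q ω ⬝ᵥ 1 ≤ 0}) (f := Z) (μ := Q)
      (ae_of_all _ fun ω => (hZpos ω).le) hZint.integrableOn).not.1 h1.not_gt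
    have hsupp : Function.support Z = univ := by
      ext ω; simp [(hZpos ω).ne']
    rw [hsupp, univ_inter, not_lt, nonpos_iff_eq_zero] at h2
    filter_upwards [measure_eq_zero_iff_ae_notMem.1 h2] with ω hω
    exact not_le.1 hω
  have hqnonneg : ∀ᵐ ω ∂Q, ∀ i, 0 ≤ q ω i := by
    refine ae_all_iff.2 fun i => ?_
    have h1 : (fun ω => q ω i) =ᵐ[Q] Q[fun ω => Z ω * stateInd i (x ω) | 𝒢] :=
      ae_eq_condExp_of_forall_setIntegral_eq h𝒢 (hind i)
        (fun B _ _ => (hqint.eval i).integrableOn) (fun B hB _ => hqset B hB i)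
        (hqi i).aestronglyMeasurable
    have h2 : 0 ≤ᵐ[Q] Q[fun ω => Z ω * stateInd i (x ω) | 𝒢] :=
      condExp_nonneg (ae_of_all _ fun ω => mul_nonneg (hZpos ω).le (by
        unfold stateInd; split_ifs <;> simp))
    filter_upwards [h1, h2] with ω h1 h2
    rw [h1]; exact h2
  -- `Q`-null sets in `𝒢` are `P`-null
  have htransfer : ∀ p : Ω → Prop, MeasurableSet[𝒢] {ω | p ω} → (∀ᵐ ω ∂Q, p ω) →
      ∀ᵐ ω ∂P, p ω := by
    intro p hp h
    have hc : MeasurableSet[𝓕] {ω | ¬ p ω} := h𝒢𝓕 _ hp.compl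
    rw [ae_iff, hP _ hc]
    exact setLIntegral_measure_zero _ _ (ae_iff.1 h)
  set g : Ω → Fin N → ℝ := fun ω => (q ω ⬝ᵥ 1)⁻¹ • q ω with hg
  have hgi : ∀ i, StronglyMeasurable[𝒢] fun ω => g ω i := fun i =>
    (hsm.measurable.inv.mul (hqi i).measurable).stronglyMeasurable
  have hgm : StronglyMeasurable[𝒢] g := stronglyMeasurable_of_eval hgi
  have hgbound : ∀ i, ∀ᵐ ω ∂Q, ‖g ω i‖ ≤ 1 := by
    intro i
    filter_upwards [hspos, hqnonneg] with ω hs hn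
    have h1 : q ω i ≤ q ω ⬝ᵥ 1 := by
      simp only [dotProduct, Pi.one_apply, mul_one]
      exact Finset.single_le_sum (f := fun i => q ω i) (fun j _ => hn j) (Finset.mem_univ i)
    have h2 : 0 ≤ g ω i := mul_nonneg (inv_nonneg.2 hs.le) (hn i)
    rw [Real.norm_of_nonneg h2]
    exact (inv_mul_le_one₀ hs).2 h1
  have hgboundP : ∀ i, ∀ᵐ ω ∂P, ‖g ω i‖ ≤ 1 := fun i =>
    htransfer _ ((hgi i).norm.measurable measurableSet_Iic) (hgbound i)
  have hgintP : Integrable g P := Integrable.of_eval fun i =>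
    Integrable.of_bound ((hgi i).mono h𝒢).aestronglyMeasurable 1 (hgboundP i)
  have hVintP : Integrable (fun ω => basisVec (x ω)) P := Integrable.of_eval fun i =>
    Integrable.of_bound (C := 1)
      (by
        simp only [basisVec_apply]
        exact ((measurable_stateInd i).comp hxm).aestronglyMeasurable)
      (ae_of_all _ fun ω => by rw [basisVec_apply]; exact abs_stateInd_le _ _)
  -- pulling the `𝒢`-measurable normalization out of `E_Q[Z | 𝒢]`
  have hpull : ∀ B, MeasurableSet[𝒢] B → ∀ i,
      ∫ ω in B, Z ω * g ω i ∂Q = ∫ ω in B, q ω i ∂Q := by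
    intro B hB i
    have hint : Integrable (Z * fun ω => g ω i) Q :=
      hZint.mul_bdd (c := 1) ((hgi i).mono h𝒢).aestronglyMeasurable (hgbound i)
    have h1 := condExp_mul_of_stronglyMeasurable_right (hgi i) hint hZint
    refine (setIntegral_condExp h𝒢 hint hB).symm.trans ?_
    refine integral_congr_ae (ae_restrict_of_ae ?_)
    filter_upwards [h1, hscond, hspos] with ω h1 h2 h3
    rw [h1, Pi.mul_apply, ← h2]
    simp only [hg, Pi.smul_apply, smul_eq_mul]
    exact mul_inv_cancel_left₀ h3.ne' _
  have hind𝓕 : ∀ B, MeasurableSet[𝒢] B → ∀ f : Ω → ℝ, StronglyMeasurable[𝓕] f →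
      ∫ ω in B, f ω ∂P = ∫ ω in B, Z ω * f ω ∂Q := by
    intro B hB f hf
    rw [← integral_indicator (h𝒢 _ hB), ← integral_indicator (h𝒢 _ hB),
      integral_eq_of_density h𝓕 hZm hZpos hP (hf.indicator (h𝒢𝓕 _ hB))]
    congr 1
    funext ω
    by_cases hω : ω ∈ B <;> simp [hω]
  have hcond : g =ᵐ[P] P[fun ω => basisVec (x ω) | 𝒢] := by
    refine ae_eq_condExp_of_forall_setIntegral_eq h𝒢 hVintP (fun B _ _ => hgintP.integrableOn)
      (fun B hB _ => ?_) hgm.aestronglyMeasurable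
    ext i
    rw [eval_integral fun j => (hgintP.eval j).integrableOn,
      eval_integral fun j => (hVintP.eval j).integrableOn]
    simp only [basisVec_apply]
    rw [hind𝓕 B hB _ ((hgi i).mono h𝒢𝓕), hpull B hB i, hqset B hB i,
      hind𝓕 B hB (fun ω => stateInd i (x ω)) ((measurable_stateInd i).comp hx).stronglyMeasurable]
  have hsposP : ∀ᵐ ω ∂P, 0 < q ω ⬝ᵥ 1 :=
    htransfer _ (hsm.measurable measurableSet_Ioi) hspos
  filter_upwards [hsposP, hcond] with ω h1 h2
  exact ⟨h1, h2.symm⟩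

end Bayes

/-! ### The unnormalized filter -/

section UnnormalizedFilter

variable {Ω : Type*} {m : MeasurableSpace Ω} {N : ℕ} {A : ℝ≥0 → Matrix (Fin N) (Fin N) ℝ}
  {X : ℝ≥0 → Ω → Fin N} {hX : ∀ t, Measurable (X t)} {Y : Ω → CountingPath} {hY : Measurable Y}
  {lam : Fin N → ℝ≥0 → CountingPath → ℝ} {T : ℝ≥0} {Q : Measure Ω}

/-- The version of `E_Q[Z_t X_t | 𝒴_t]` obtained by integrating over an independent copy of the
chain, with the observed path held fixed. -/
def filterVersion (lam : Fin N → ℝ≥0 → CountingPath → ℝ) (X : ℝ≥0 → Ω → Fin N)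
    (Y : Ω → CountingPath) (Q : Measure Ω) (t : ℝ≥0) (ω : Ω) : Fin N → ℝ :=
  pathFilter (pathIntensity lam (Y ω)) X (jumpFinset (Y ω) t) Q t

theorem filterVersion_eq {t : ℝ≥0} (ht : t ≤ T) (ω : Ω) : filterVersion lam X Y Q t ω
    = pathFilter (pathIntensity lam (Y ω)) X (jumpFinset (Y ω) T) Q t := by
  funext i
  simp only [filterVersion, pathFilter, weight_jumpFinset ht]

theorem obsFiltration_eq_comap (Y : Ω → CountingPath) (hY : Measurable Y) (t : ℝ≥0) :
    obsFiltration Y hY t = MeasurableSpace.comap Y (pathFiltration t) := by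
  simp only [obsFiltration, pathFiltration, Filtration.natural, MeasurableSpace.comap_iSup,
    MeasurableSpace.comap_comp]
  rfl

theorem leftLim_eq_of_tendsto_Icc {E : Type*} [TopologicalSpace E] [T2Space E] {f : ℝ≥0 → E}
    {l : E} {u : ℝ≥0} (hu : u ∈ Ioc 0 T) (h : Tendsto f (𝓝[Icc 0 T ∩ Iio u] u) (𝓝 l)) :
    Function.leftLim f u = l := by
  have := nhdsLT_neBot_of_pos hu.1
  have hs : Icc 0 T ∩ Iio u = Iio u :=
    inter_eq_right.2 fun v hv => ⟨zero_le, (mem_Iio.1 hv).le.trans hu.2⟩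
  rw [hs] at h
  exact leftLim_eq_of_tendsto h

theorem jumpTerm_apply (y : CountingPath) (q : ℝ≥0 → Fin N → ℝ) (u : ℝ≥0) (i : Fin N) :
    jumpTerm lam y q u i = (lam i u y - 1) * Function.leftLim q u i := by
  simp [jumpTerm, Lam, Matrix.sub_mulVec, Matrix.mulVec_diagonal, sub_mul]

/-- A path that agrees on `[0,T]` with the unnormalized filter along `y` solves the filter
equation. -/
theorem solvesFilterEquation_of_eq [IsProbabilityMeasure Q] (h : IsMarkovChain A X hX Q)
    (hlam : IsIntensity lam) {y : CountingPath}
    (hint : ∀ᵐ ω ∂Q, IntegrableOn (chainIntensity (pathIntensity lam y) X ω) (Ioc 0 T) leb)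
    {q : ℝ≥0 → Fin N → ℝ}
    (hq : ∀ t ≤ T, q t = pathFilter (pathIntensity lam y) X (jumpFinset y T) Q t) :
    SolvesFilterEquation A lam T y q := by
  set c := pathIntensity lam y
  set J := jumpFinset y T
  have hc : ∀ i, Measurable (c i) := hlam.measurable_pathIntensity y
  have hcpos : ∀ i u, 0 < c i u := fun i u => hlam.pos i u y
  have hJ : ∀ s ∈ J, s ∈ Ioc 0 T := fun s hs => (mem_jumpFinset.1 hs).1
  have hleft : ∀ u ∈ Ioc 0 T, Function.leftLim q u = leftPathFilter c X J Q u := by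
    intro u hu
    refine leftLim_eq_of_tendsto_Icc hu ?_
    refine (tendsto_pathFilter_left h.cadlag hX hc hcpos hint ⟨zero_le, hu.2⟩).congr' ?_
    exact eventually_nhdsWithin_of_forall fun s hs => (hq s hs.1.2).symm
  have hterm : ∀ u ∈ Ioc 0 T, ∀ i,
      jumpTerm lam y q u i = (c i u - 1) * leftPathFilter c X J Q u i := fun u hu i => by
    rw [jumpTerm_apply, hleft u hu]; rfl
  have hjumpT : ∀ i, IntegrableOn (fun u => jumpTerm lam y q u i) (Ioc 0 T) leb := fun i =>
    (integrableOn_jumpTerm_pathFilter h hc hcpos hint hJ i).congr_fun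
      (fun u hu => (hterm u hu i).symm) measurableSet_Ioc
  intro t ht
  have hsub : Ioc 0 t ⊆ Ioc 0 T := Ioc_subset_Ioc_right ht
  have hgen : ∀ u ∈ Ioc 0 t, ∀ i,
      (A u *ᵥ q u) i = ∑ k, A u i k * pathFilter c X J Q u k := fun u hu i => by
    rw [hq u (hu.2.trans ht)]; rfl
  have hgent : ∀ i, IntegrableOn (fun u => (A u *ᵥ q u) i) (Ioc 0 t) leb := fun i =>
    IntegrableOn.congr_fun (integrable_finsetSum _ fun k _ =>
        integrableOn_generatorTerm_pathFilter h hc hcpos hint ht i k)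
      (fun u hu => (hgen u hu i).symm) measurableSet_Ioc
  refine ⟨Integrable.of_eval fun i => (hjumpT i).mono_set hsub, Integrable.of_eval hgent, ?_⟩
  ext i
  have h1 := pathFilter_equation h hc hcpos hint hJ ht i
  have h2 := setIntegral_drive_sign hJ (hjumpT i) ht
  have h3 : ∫ u in Ioc 0 t, driveSign J u * ((c i u - 1) * leftPathFilter c X J Q u i) ∂drive J T
      = ∫ u in Ioc 0 t, driveSign J u • jumpTerm lam y q u i ∂drive J T :=
    setIntegral_congr_fun measurableSet_Ioc fun u hu => by
      simp only [hterm u (hsub hu) i, smul_eq_mul]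
  have h4 : ∫ u in Ioc 0 t, ∑ k, A u i k * pathFilter c X J Q u k ∂leb
      = ∫ u in Ioc 0 t, (A u *ᵥ q u) i ∂leb :=
    setIntegral_congr_fun measurableSet_Ioc fun u hu => (hgen u hu i).symm
  rw [h3, h2, h4] at h1
  simp only [Pi.add_apply, Pi.sub_apply]
  rw [eval_integral hgent, eval_integral fun j => (hjumpT j).mono_set hsub,
    jumpIntegral_eq_sum y ht, Finset.sum_apply, hq t ht, hq 0 zero_le]
  exact h1

/-- Two processes that are càdlàg on `[0,T]` and agree almost surely at every fixed time are
indistinguishable on `[0,T]`. -/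
theorem ae_forall_eq_of_cadlag {E : Type*} [TopologicalSpace E] [T2Space E] {f g : ℝ≥0 → Ω → E}
    (hf : ∀ᵐ ω ∂Q, IsCadlagOn (Icc 0 T) fun t => f t ω)
    (hg : ∀ᵐ ω ∂Q, IsCadlagOn (Icc 0 T) fun t => g t ω)
    (hfg : ∀ t ≤ T, f t =ᵐ[Q] g t) : ∀ᵐ ω ∂Q, ∀ t ≤ T, f t ω = g t ω := by
  obtain ⟨D, hDc, hDd⟩ := TopologicalSpace.exists_countable_dense ℝ≥0
  have hD : ∀ᵐ ω ∂Q, ∀ t ∈ D, t ≤ T → f t ω = g t ω :=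
    (ae_ball_iff hDc).2 fun t _ => by
      by_cases ht : t ≤ T
      · filter_upwards [hfg t ht] with ω hω _ using hω
      · exact ae_of_all _ fun ω h => absurd h ht
  filter_upwards [hf, hg, hD, hfg T le_rfl] with ω hf hg hD hT t ht
  rcases ht.eq_or_lt with rfl | htT
  · exact hT
  have hmem : t ∈ closure (Ioo t T ∩ D) := by
    have h1 : t ∈ closure (Ioo t T) := by
      rw [closure_Ioo htT.ne]; exact left_mem_Icc.2 ht
    have h2 := closure_mono (hDd.open_subset_closure_inter (isOpen_Ioo (a := t) (b := T)))
    rw [closure_closure] at h2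
    exact h2 h1
  have hne : (𝓝[Ioo t T ∩ D] t).NeBot := mem_closure_iff_nhdsWithin_neBot.1 hmem
  have hsub : Ioo t T ∩ D ⊆ Icc 0 T ∩ Ici t :=
    fun u hu => ⟨⟨zero_le, hu.1.2.le⟩, hu.1.1.le⟩
  have h1 : Tendsto (fun u => f u ω) (𝓝[Ioo t T ∩ D] t) (𝓝 (f t ω)) :=
    (hf t ⟨zero_le, ht⟩).1.mono_left (nhdsWithin_mono _ hsub)
  have h2 : Tendsto (fun u => g u ω) (𝓝[Ioo t T ∩ D] t) (𝓝 (g t ω)) :=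
    (hg t ⟨zero_le, ht⟩).1.mono_left (nhdsWithin_mono _ hsub)
  refine tendsto_nhds_unique h1 (h2.congr' ?_)
  exact eventually_nhdsWithin_of_forall fun u hu => (hD u hu.2 hu.1.2.le).symm

section Independence

/-- The σ-algebra generated by the whole path of the chain. -/
abbrev chainSigma (X : ℝ≥0 → Ω → Fin N) : MeasurableSpace Ω :=
  MeasurableSpace.comap (fun ω t => X t ω) inferInstance

theorem measurable_chainSigma (X : ℝ≥0 → Ω → Fin N) (t : ℝ≥0) : Measurable[chainSigma X] (X t) :=
  (measurable_pi_apply t).comp (comap_measurable fun ω t => X t ω)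

theorem chainSigma_le (hX : ∀ t, Measurable (X t)) : chainSigma X ≤ m :=
  (measurable_pi_lambda _ hX).comap_le

/-- Independence in terms of the identity from `Ω` to `Ω` with the σ-algebra of the chain. On this
target, unlike on the product space of all functions of time, the left-limit process is jointly
measurable. -/
theorem indepFun_id_chainSigma (hindep : IndepFun (fun ω t => X t ω) Y Q) :
    @IndepFun Ω Ω CountingPath m (chainSigma X) _ id Y Q := by
  rw [@IndepFun_iff_Indep _ _ _ _ (chainSigma X), MeasurableSpace.comap_id]
  exact (IndepFun_iff_Indep _ _ _).1 hindep

variable [IsProbabilityMeasure Q]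

theorem ae_ae_integrableOn_intensity (hX : ∀ t, Measurable (X t))
    (hcad : ∀ ω, IsCadlagOn univ fun t => X t ω)
    (hY : Measurable Y) (hindep : IndepFun (fun ω t => X t ω) Y Q) (hlam : IsIntensity lam)
    (hlamInt : ∀ᵐ ω ∂Q, IntegrableOn (fun u => intensity lam X Y u ω) (Ioc 0 T) leb) :
    ∀ᵐ ω ∂Q, ∀ᵐ ω' ∂Q,
      IntegrableOn (chainIntensity (pathIntensity lam (Y ω)) X ω') (Ioc 0 T) leb := by
  refine ae_of_ae_map hY.aemeasurable (p := fun y => ∀ᵐ ω' ∂Q,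
    IntegrableOn (chainIntensity (pathIntensity lam y) X ω') (Ioc 0 T) leb) ?_
  exact ae_decoupled (mS := chainSigma X) (W := id) (measurable_id'' (chainSigma_le hX)) hY
    (indepFun_id_chainSigma hindep)
    (p := fun ω' y => IntegrableOn (chainIntensity (pathIntensity lam y) X ω') (Ioc 0 T) leb)
    (measurableSet_integrableOn_intensity (m := chainSigma X) hcad (measurable_chainSigma X)
      hlam T) hlamInt

theorem filterVersion_ae_eq_condExp (hX : ∀ t, Measurable (X t))
    (hcad : ∀ ω, IsCadlagOn univ fun t => X t ω)
    (hY : Measurable Y) (hindep : IndepFun (fun ω t => X t ω) Y Q) (hlam : IsIntensity lam)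
    (hlamInt : ∀ᵐ ω ∂Q, IntegrableOn (fun u => intensity lam X Y u ω) (Ioc 0 T) leb)
    {t : ℝ≥0} (ht : t ≤ T) (hZ : Integrable (density lam X Y t) Q) :
    filterVersion lam X Y Q t
      =ᵐ[Q] Q[fun ω => density lam X Y t ω • basisVec (X t ω) | obsFiltration Y hY t] := by
  set F : Ω × CountingPath → Fin N → ℝ := fun p =>
    weight (chainIntensity (pathIntensity lam p.2) X p.1) (jumpFinset p.2 t) t
      • basisVec (X t p.1) with hF
  have hFi : ∀ p i, F p i = weight (chainIntensity (pathIntensity lam p.2) X p.1)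
      (jumpFinset p.2 t) t * stateInd i (X t p.1) := fun p i => by
    simp [hF, basisVec_apply]
  have hFm : StronglyMeasurable[(chainSigma X).prod (pathFiltration t)] F := by
    refine stronglyMeasurable_of_eval fun i => ?_
    simp only [hFi]
    have h1 := measurable_decoupled_weight (m := chainSigma X) hcad (measurable_chainSigma X)
      hlam t
    have h2 : Measurable[(chainSigma X).prod (pathFiltration t)]
        fun p : Ω × CountingPath => stateInd i (X t p.1) :=
      (measurable_stateInd i).comp ((measurable_chainSigma X t).comp
        (@measurable_fst _ _ (chainSigma X) (pathFiltration t)))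
    exact (h1.mul h2).stronglyMeasurable
  have hdens : (fun ω => density lam X Y t ω • basisVec (X t ω)) = fun ω => F (id ω, Y ω) := by
    funext ω
    rw [density_eq_weight]; rfl
  have hint : Integrable (fun ω => F (id ω, Y ω)) Q := by
    rw [← hdens]
    refine Integrable.of_eval fun i => ?_
    simpa [basisVec_apply] using integrable_mul_stateInd hZ (hX t) i
  rw [obsFiltration_eq_comap, hdens]
  refine EventuallyEq.trans ?_ (condExp_decoupled (mS := chainSigma X) (W := id)
    (measurable_id'' (chainSigma_le hX)) hY (indepFun_id_chainSigma hindep)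
    (pathFiltration.le t) hFm hint)
  filter_upwards [ae_ae_integrableOn_intensity hX hcad hY hindep hlam hlamInt] with ω hω
  funext i
  rw [eval_integral]
  · simp only [hFi]; rfl
  · intro j
    simp only [hFi, id]
    have hc : ∀ i, Measurable (pathIntensity lam (Y ω) i) := hlam.measurable_pathIntensity _
    exact Integrable.of_bound (measurable_weight_mul_stateInd hcad hX hc t j).aestronglyMeasurable
      _ (ae_abs_weight_mul_stateInd_le (fun i u => hlam.pos i u _) hω ht (X t) j)

theorem stronglyMeasurable_filterVersion (hX : ∀ t, Measurable (X t))
    (hcad : ∀ ω, IsCadlagOn univ fun t => X t ω) (hY : Measurable Y) (hlam : IsIntensity lam)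
    (t : ℝ≥0) : StronglyMeasurable[obsFiltration Y hY t] (filterVersion lam X Y Q t) := by
  rw [obsFiltration_eq_comap]
  refine stronglyMeasurable_of_eval fun i => ?_
  have h1 : StronglyMeasurable[m.prod (pathFiltration t)] fun p : Ω × CountingPath =>
      weight (chainIntensity (pathIntensity lam p.2) X p.1) (jumpFinset p.2 t) t
        * stateInd i (X t p.1) := by
    have h2 : Measurable[m.prod (pathFiltration t)]
        fun p : Ω × CountingPath => stateInd i (X t p.1) :=
      (measurable_stateInd i).comp ((hX t).comp (@measurable_fst _ _ m (pathFiltration t)))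
    exact ((measurable_decoupled_weight hcad hX hlam t).mul h2).stronglyMeasurable
  have h3 := @StronglyMeasurable.integral_prod_left' _ _ _ _ (pathFiltration t) Q _ _ _ _ h1
  exact h3.comp_measurable (@comap_measurable _ _ (pathFiltration t) Y)

theorem cadlag_filterVersion (h : IsMarkovChain A X hX Q)
    (hY : Measurable Y) (hindep : IndepFun (fun ω t => X t ω) Y Q) (hlam : IsIntensity lam)
    (hlamInt : ∀ᵐ ω ∂Q, IntegrableOn (fun u => intensity lam X Y u ω) (Ioc 0 T) leb) :
    ∀ᵐ ω ∂Q, IsCadlagOn (Icc 0 T) fun t => filterVersion lam X Y Q t ω := by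
  filter_upwards [ae_ae_integrableOn_intensity hX h.cadlag hY hindep hlam hlamInt] with ω hω
  have hc : ∀ i, Measurable (pathIntensity lam (Y ω) i) := hlam.measurable_pathIntensity _
  have hcpos : ∀ i u, 0 < pathIntensity lam (Y ω) i u := fun i u => hlam.pos i u _
  intro t ht
  refine ⟨?_, _, (tendsto_pathFilter_left (J := jumpFinset (Y ω) T) h.cadlag hX hc hcpos hω
    ht).congr' ?_⟩
  · have := (tendsto_pathFilter_right (J := jumpFinset (Y ω) T) h.cadlag hX hc hcpos hω ht)
    rw [← filterVersion_eq ht.2] at this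
    refine this.congr' ?_
    exact eventually_nhdsWithin_of_forall fun s hs => (filterVersion_eq hs.1.2 ω).symm
  · exact eventually_nhdsWithin_of_forall fun s hs => (filterVersion_eq hs.1.2 ω).symm

end Independence

theorem obsFiltration_le_fullFiltration (t : ℝ≥0) :
    obsFiltration Y hY t ≤ fullFiltration X hX Y hY t := by
  simp only [obsFiltration, fullFiltration, Filtration.natural]
  refine iSup₂_mono fun s _ => ?_
  rintro _ ⟨B, hB, rfl⟩
  exact ⟨Prod.snd ⁻¹' B, measurable_snd hB, rfl⟩

theorem measurable_fullFiltration (t : ℝ≥0) : Measurable[fullFiltration X hX Y hY t] (X t) :=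
  measurable_fst.comp (Filtration.stronglyAdapted_natural (u := fun t ω => (X t ω, (Y ω).1 t))
    (fun t => ((hX t).prodMk ((measurable_eval t).comp hY)).stronglyMeasurable) t).measurable

end UnnormalizedFilter

end CountingFilter

end

theorem mainTheorem1 {Ω : Type*} {m : MeasurableSpace Ω} {N : ℕ}
    (Q : Measure Ω) [IsProbabilityMeasure Q]
    (A : ℝ≥0 → Matrix (Fin N) (Fin N) ℝ)
    (X : ℝ≥0 → Ω → Fin N) (hX : ∀ t, Measurable (X t))
    (Y : Ω → CountingFilter.CountingPath) (hY : Measurable Y)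
    (lam : Fin N → ℝ≥0 → CountingFilter.CountingPath → ℝ) (T : ℝ≥0)
    (hchain : CountingFilter.IsMarkovChain A X hX Q)
    (hpoisson : CountingFilter.IsStandardPoisson Y Q)
    (hindep : IndepFun (fun ω t => X t ω) Y Q)
    (hlam : CountingFilter.IsIntensity lam)
    (hlamLeft : ∀ᵐ ω ∂Q, ∀ t,
      ContinuousWithinAt (fun u => CountingFilter.intensity lam X Y u ω) (Iic t) t)
    (hlamInt : ∀ᵐ ω ∂Q,
      IntegrableOn (fun u => CountingFilter.intensity lam X Y u ω) (Ioc 0 T) CountingFilter.leb)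
    (hZ : Martingale (fun t => CountingFilter.density lam X Y (min t T))
      (CountingFilter.fullFiltration X hX Y hY) Q) :
    (∃ q, CountingFilter.IsUnnormalizedFilter lam X Y hY Q T q) ∧
    ∀ q, CountingFilter.IsUnnormalizedFilter lam X Y hY Q T q →
      (∀ᵐ ω ∂Q, CountingFilter.SolvesFilterEquation A lam T (Y ω) (fun t => q t ω)) ∧
      ∀ P : Measure Ω, IsProbabilityMeasure P →
        CountingFilter.HasDensityProcess P Q (CountingFilter.fullFiltration X hX Y hY) T
          (CountingFilter.density lam X Y) →
        ∀ t ≤ T, ∀ᵐ ω ∂P, 0 < q t ω ⬝ᵥ 1 ∧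
          P[fun ω' => CountingFilter.basisVec (X t ω') | CountingFilter.obsFiltration Y hY t] ω
            = (q t ω ⬝ᵥ 1)⁻¹ • q t ω := by
  have hZint : ∀ t ≤ T, Integrable (CountingFilter.density lam X Y t) Q := fun t ht => by
    simpa only [min_eq_left ht] using hZ.integrable t
  have hcond := fun t (ht : t ≤ T) => CountingFilter.filterVersion_ae_eq_condExp hX
    hchain.cadlag hY hindep hlam hlamInt ht (hZint t ht)
  have hcad := CountingFilter.cadlag_filterVersion hchain hY hindep hlam hlamInt
  refine ⟨⟨CountingFilter.filterVersion lam X Y Q, fun t _ =>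
    CountingFilter.stronglyMeasurable_filterVersion hX hchain.cadlag hY hlam t, hcond, hcad⟩,
    fun q hq => ⟨?_, fun P hPprob hP t ht => ?_⟩⟩
  · have heq := CountingFilter.ae_forall_eq_of_cadlag hq.cadlag hcad
      fun t ht => (hq.condExp t ht).trans (hcond t ht).symm
    filter_upwards [heq, CountingFilter.ae_ae_integrableOn_intensity hX hchain.cadlag hY hindep
      hlam hlamInt] with ω hω hint
    exact CountingFilter.solvesFilterEquation_of_eq hchain hlam hint fun t ht =>
      (hω t ht).trans (CountingFilter.filterVersion_eq ht ω)
  · have hZm := hZ.stronglyAdapted t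
    simp only [min_eq_left ht] at hZm
    exact CountingFilter.bayes_formula (CountingFilter.obsFiltration_le_fullFiltration t)
      ((CountingFilter.fullFiltration X hX Y hY).le t) hZm
      (CountingFilter.density_pos hlam X Y t) (hZint t ht) (hP t ht)
      (CountingFilter.measurable_fullFiltration t) (hq.adapted t ht) (hq.condExp t ht)
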